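/- Let $n\in\mathbb N$, $1<p<\infty$, $t>0$. For $s>0$ let $d\mu_s(z)=(\pi s)^{-n}e^{-|z|^2/s}\,dV(z)$ on $\mathbb C^n$, where $V$ is Lebesgue measure, and let $F_t^p=L^p(\mathbb C^n,\mu_{2t/p})\cap\operatorname{Hol}(\mathbb C^n)$ be the $p$-Fock space with the $L^p(\mu_{2t/p})$-norm. For $z\in\mathbb C^n$ put $k_z^t(w)=e^{w\cdot\overline z/t-|z|^2/(2t)}$ and let $W_z\in\mathcal L(F_t^p)$ be the Weyl operator $W_zf(w)=k_z^t(w)f(w-z)$. Define $\alpha_z(A)=W_zAW_{-z}$ for $A\in\mathcal L(F_t^p)$ and $\alpha_z(f)(w)=f(w-z)$ for functions $f$ on $\mathbb C^n$; a set of operators or functions is called $\alpha$-invariant if it is mapped into itself by every $\alpha_z$, $z\in\mathbb C^n$. For $f\in L^\infty(\mathbb C^n)$ let $T_f^t\in\mathcal L(F_t^p)$ be the Toeplitz operator $$T_f^tg(z)=\int_{\mathbb C^n}e^{z\cdot\overline w/t}f(w)g(w)\,d\mu_t(w).$$ Let $\mathcal T^{p,t}\subseteq\mathcal L(F_t^p)$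 be the norm-closed algebra generated by all $T_f^t$, $f\in L^\infty(\mathbb C^n)$, and for a set $\mathcal D\subseteq L^\infty(\mathbb C^n)$ let $\mathcal T_{lin}^{p,t}(\mathcal D)$ be the norm-closed linear span of $\{T_f^t:f\in\mathcal D\}$. The Berezin transform of $A\in\mathcal L(F_t^p)$ is $\widetilde A(z)=\int_{\mathbb C^n}(Ak_z^t)(w)\overline{k_z^t(w)}\,d\mu_t(w)$. Let $\operatorname{BUC}(\mathbb C^n)$ be the space of bounded uniformly continuous functions $\mathbb C^n\to\mathbb C$ with the supremum norm. Let $\mathcal S\subseteq\mathcal T^{p,t}$ be a norm-closed $\alpha$-invariant linear subspace (not necessarily an algebra). Then $\widetilde A\in\operatorname{BUC}(\mathbb C^n)$ for every $A\in\mathcal S$, and there is a closed $\alpha$-invariant linear subspace $\mathcal D_0\subseteq\operatorname{BUC}(\mathbb C^n)$ such that $$\mathcal S=\mathcal T_{lin}^{p,t}(\mathcal D_0).$$ Further, every such $\mathcal D_0$ is given by $\mathcal D_0=\overline{\operatorname{span}}\{\widetilde A:A\in\mathcal S\}$ (closure in the supremum norm); in particular $\mathcal D_0$ is unique. -/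

import Mathlib

open MeasureTheory Topology
open scoped ENNReal BoundedContinuousFunction ComplexConjugate

noncomputable section

namespace Fock

/-! ### Points of `ℂⁿ` and Gaussian measures -/

/-- The space `ℂⁿ`.  The Euclidean norm enters only through `normSq`; Lebesgue measure is the
product measure `volume`. -/
abbrev Cn (n : ℕ) : Type := Fin n → ℂ

variable {n : ℕ}

/-- `|z|²`, the square of the Euclidean norm on `ℂⁿ`. -/
def normSq (z : Cn n) : ℝ := ∑ i, ‖z i‖ ^ 2

/-- `w · \overline z`. -/
def herm (w z : Cn n) : ℂ := ∑ i, w i * conj (z i)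

/-- The Gaussian measure `dμ_s(z) = (π s)⁻ⁿ exp(-|z|²/s) dV(z)`. -/
def gaussian (n : ℕ) (s : ℝ) : Measure (Cn n) :=
  volume.withDensity fun z => ENNReal.ofReal (1 / (Real.pi * s) ^ n * Real.exp (-normSq z / s))

/-- Normalized reproducing kernel `k_z^t(w) = exp(w · \overline z / t - |z|² / (2t))`. -/
def kernelFun (t : ℝ) (z w : Cn n) : ℂ :=
  Complex.exp (herm w z / (t : ℂ) - (normSq z : ℂ) / (2 * (t : ℂ)))

/-- `P_t h (z) = ∫ exp(z · \overline w / t) h(w) dμ_t(w)`. -/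
def bergmanProj (t : ℝ) (h : Cn n → ℂ) (z : Cn n) : ℂ :=
  ∫ w, Complex.exp (herm z w / (t : ℂ)) * h w ∂(gaussian n t)

lemma continuous_normSq : Continuous (normSq (n := n)) := by
  unfold normSq; fun_prop

lemma normSq_nonneg (z : Cn n) : 0 ≤ normSq z :=
  Finset.sum_nonneg fun _ _ => by positivity

lemma normSq_neg (z : Cn n) : normSq (-z) = normSq z := by simp [normSq]

lemma normSq_sub (w z : Cn n) : normSq (w - z) = normSq w - 2 * (herm w z).re + normSq z := by
  simp only [normSq, herm, Complex.re_sum, Finset.mul_sum, ← Finset.sum_sub_distrib,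
    ← Finset.sum_add_distrib]
  refine Finset.sum_congr rfl fun i _ => ?_
  simp only [← Complex.normSq_eq_norm_sq, Complex.normSq_apply, Pi.sub_apply, Complex.sub_re,
    Complex.sub_im, Complex.mul_re, Complex.conj_re, Complex.conj_im]
  ring

lemma norm_herm_le (z w : Cn n) : ‖herm z w‖ ≤ ‖z‖ * ∑ i, ‖w i‖ := by
  refine (norm_sum_le _ _).trans ?_
  rw [Finset.mul_sum]
  refine Finset.sum_le_sum fun i _ => ?_
  rw [norm_mul, RCLike.norm_conj]
  gcongr
  exact norm_le_pi_norm z i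

/-- `exp(-|z|²/(2t))`, the weight that turns `L^p(μ_{2t/p})` into `L^p(dV)`. -/
def weight (t : ℝ) (z : Cn n) : ℝ≥0∞ := ENNReal.ofReal (Real.exp (-normSq z / (2 * t)))

lemma measurable_weight (t : ℝ) : Measurable (weight (n := n) t) := by
  have := continuous_normSq (n := n)
  unfold weight
  fun_prop

/-- The normalizing constant of `μ_s`. -/
def gconst (n : ℕ) (s : ℝ) : ℝ≥0∞ := ENNReal.ofReal (1 / (Real.pi * s) ^ n)

lemma gconst_ne_top (s : ℝ) : gconst n s ≠ ∞ := ENNReal.ofReal_ne_top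

lemma gconst_ne_zero {s : ℝ} (hs : 0 < s) : gconst n s ≠ 0 := by
  unfold gconst; have := Real.pi_pos; simp; positivity

lemma lintegral_gaussian {s : ℝ} (hs : 0 < s) (g : Cn n → ℝ≥0∞) :
    ∫⁻ w, g w ∂(gaussian n s) =
      gconst n s * ∫⁻ w, g w * ENNReal.ofReal (Real.exp (-normSq w / s)) := by
  have hm : Measurable fun z : Cn n => Real.exp (-normSq z / s) := by
    have := continuous_normSq (n := n)
    fun_prop
  unfold gaussian gconst
  rw [lintegral_withDensity_eq_lintegral_mul_non_measurable]
  · rw [← lintegral_const_mul' _ _ ENNReal.ofReal_ne_top]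
    refine lintegral_congr fun w => ?_
    rw [Pi.mul_apply, ENNReal.ofReal_mul (by have := Real.pi_pos; positivity)]
    ring
  · exact (measurable_const.mul hm).ennreal_ofReal
  · filter_upwards with x using ENNReal.ofReal_lt_top

lemma gaussian_absolutelyContinuous (s : ℝ) : gaussian n s ≪ volume :=
  withDensity_absolutelyContinuous _ _

lemma absolutelyContinuous_gaussian {s : ℝ} (hs : 0 < s) : volume ≪ gaussian n s := by
  unfold gaussian
  apply withDensity_absolutelyContinuous'
  · have := continuous_normSq (n := n)
    fun_prop
  · filter_upwards with x
    have := Real.pi_pos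
    simp only [ne_eq, ENNReal.ofReal_eq_zero, not_le]
    positivity

lemma eLpNorm_gaussian {p t : ℝ} (hp : 1 < p) (ht : 0 < t) (F : Cn n → ℂ) :
    eLpNorm F (ENNReal.ofReal p) (gaussian n (2 * t / p)) =
      (gconst n (2 * t / p) * ∫⁻ w, (‖F w‖ₑ * weight t w) ^ p) ^ (1 / p) := by
  have hp0 : 0 < p := by linarith
  rw [eLpNorm_eq_lintegral_rpow_enorm_toReal (by simpa using hp0) ENNReal.ofReal_ne_top,
    ENNReal.toReal_ofReal hp0.le, lintegral_gaussian (by positivity)]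
  congr 2
  refine lintegral_congr fun w => ?_
  rw [ENNReal.mul_rpow_of_nonneg _ _ hp0.le]
  congr 1
  rw [weight, ENNReal.ofReal_rpow_of_pos (Real.exp_pos _), ← Real.exp_mul]
  congr 2
  field_simp

lemma integrable_exp_neg_normSq {c : ℝ} (hc : 0 < c) :
    Integrable fun w : Cn n => Real.exp (-c * normSq w) := by
  have h1 : Integrable fun x : ℂ => Real.exp (-c * ‖x‖ ^ 2) := by
    have := (GaussianFourier.integrable_cexp_neg_mul_sq_norm_add (V := ℂ) (b := (c : ℂ))
      (by simpa using hc) 0 0).norm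
    refine this.congr (Filter.Eventually.of_forall fun x => ?_)
    simp [Complex.norm_exp, ← Complex.ofReal_pow]
  have := Integrable.fintype_prod (ι := Fin n) (𝕜 := ℝ) (μ := fun _ => (volume : Measure ℂ))
    (f := fun _ x => Real.exp (-c * ‖x‖ ^ 2)) (fun _ => h1)
  refine this.congr (Filter.Eventually.of_forall fun x => ?_)
  simp [← Real.exp_sum, normSq, Finset.mul_sum]

lemma lintegral_exp_lt_top {c : ℝ} (hc : 0 < c) (R : ℝ) :
    ∫⁻ w : Cn n, ENNReal.ofReal (Real.exp (R * ∑ i, ‖w i‖ - c * normSq w)) < ∞ := by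
  have h := (integrable_exp_neg_normSq (n := n) (half_pos hc)).const_mul
    (Real.exp (n * (R ^ 2 / (2 * c))))
  have h2 := h.lintegral_lt_top
  refine lt_of_le_of_lt (lintegral_mono fun w => ENNReal.ofReal_le_ofReal ?_) h2
  rw [← Real.exp_add]
  refine Real.exp_le_exp.mpr ?_
  have : ∑ i, (R * ‖w i‖ - c * ‖w i‖ ^ 2) ≤
      ∑ _i : Fin n, R ^ 2 / (2 * c) + ∑ i, (-(c / 2) * ‖w i‖ ^ 2) := by
    rw [← Finset.sum_add_distrib]
    refine Finset.sum_le_sum fun i _ => ?_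
    have : 0 ≤ (R - c * ‖w i‖) ^ 2 / (2 * c) := by positivity
    have e : (R - c * ‖w i‖) ^ 2 / (2 * c) =
      R ^ 2 / (2 * c) - R * ‖w i‖ + c / 2 * ‖w i‖ ^ 2 := by field_simp; ring
    linarith
  simpa [normSq, Finset.mul_sum, Finset.sum_sub_distrib] using this

/-- Weighted Hölder bound: elements of `L^p(μ_{2t/p})` are integrable against
`exp(R ∑ |w_i|) dμ_t`. -/
lemma integrable_exp_mul {p t : ℝ} (hp : 1 < p) (ht : 0 < t) {h : Cn n → ℂ}
    (hh : MemLp h (ENNReal.ofReal p) (gaussian n (2 * t / p))) (R : ℝ) :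
    Integrable (fun w => Real.exp (R * ∑ i, ‖w i‖) * ‖h w‖) (gaussian n t) := by
  have hp0 : 0 < p := by linarith
  have hvol : AEStronglyMeasurable h volume :=
    hh.1.mono_ac (absolutelyContinuous_gaussian (by positivity))
  have hmeas : AEStronglyMeasurable h (gaussian n t) :=
    hvol.mono_ac (gaussian_absolutelyContinuous t)
  refine ⟨?_, ?_⟩
  · refine AEStronglyMeasurable.mul ?_ hmeas.norm
    exact Continuous.aestronglyMeasurable (by fun_prop)
  rw [hasFiniteIntegral_iff_enorm, lintegral_gaussian ht]
  refine ENNReal.mul_lt_top (gconst_ne_top t).lt_top ?_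
  have hpq : p.HolderConjugate (p.conjExponent) := Real.HolderConjugate.conjExponent hp
  set q := p.conjExponent with hq
  set E : Cn n → ℝ≥0∞ := fun w =>
    ENNReal.ofReal (Real.exp (R * ∑ i, ‖w i‖ - 1 / (2 * t) * normSq w)) with hE
  have hEm : Measurable E := by
    have := continuous_normSq (n := n)
    fun_prop
  have hfin : ∫⁻ w, (‖h w‖ₑ * weight t w) ^ p < ∞ := by
    have := hh.2
    rw [eLpNorm_gaussian hp ht] at this
    have h2 : gconst n (2 * t / p) * ∫⁻ w, (‖h w‖ₑ * weight t w) ^ p < ∞ := by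
      by_contra hcon
      rw [not_lt, top_le_iff] at hcon
      rw [hcon, ENNReal.top_rpow_of_pos (by positivity)] at this
      exact lt_irrefl _ this
    by_contra hcon
    rw [not_lt, top_le_iff] at hcon
    rw [hcon, ENNReal.mul_top (gconst_ne_zero (by positivity))] at h2
    exact lt_irrefl _ h2
  calc ∫⁻ w, ‖Real.exp (R * ∑ i, ‖w i‖) * ‖h w‖‖ₑ * ENNReal.ofReal (Real.exp (-normSq w / t))
      = ∫⁻ w, ((fun w => ‖h w‖ₑ * weight t w) * E) w := by
        refine lintegral_congr fun w => ?_
        simp only [Pi.mul_apply, hE, weight, enorm_mul, enorm_norm]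
        rw [Real.enorm_of_nonneg (Real.exp_nonneg _), mul_assoc (‖h w‖ₑ),
          ← ENNReal.ofReal_mul (Real.exp_nonneg _), ← Real.exp_add,
          mul_comm _ (‖h w‖ₑ), mul_assoc,
          ← ENNReal.ofReal_mul (Real.exp_nonneg _), ← Real.exp_add]
        congr 3
        field_simp
        ring
    _ ≤ _ := ENNReal.lintegral_mul_le_Lp_mul_Lq volume hpq
        ((hvol.enorm).mul (measurable_weight t).aemeasurable) hEm.aemeasurable
    _ < ∞ := by
        refine ENNReal.mul_lt_top (ENNReal.rpow_lt_top_of_nonneg (by positivity) hfin.ne) ?_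
        refine ENNReal.rpow_lt_top_of_nonneg (one_div_nonneg.mpr hpq.symm.nonneg) ?_
        have hq0 : 0 < q := hpq.symm.pos
        have := lintegral_exp_lt_top (n := n) (c := 1 / (2 * t) * q) (by positivity) (R * q)
        convert! this.ne using 3 with w
        rw [hE]
        simp only
        rw [ENNReal.ofReal_rpow_of_pos (Real.exp_pos _), ← Real.exp_mul]
        congr 2
        ring

/-! ### The Fock space -/

/-- The entire functions on `ℂⁿ` that are `p`-integrable with respect to `μ_{2t/p}`. -/
def fockSubmodule (n : ℕ) (p t : ℝ) : Submodule ℂ (Cn n → ℂ) where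
  carrier := {f | Differentiable ℂ f ∧ MemLp f (ENNReal.ofReal p) (gaussian n (2 * t / p))}
  add_mem' := fun hf hg => ⟨hf.1.add hg.1, hf.2.add hg.2⟩
  zero_mem' := ⟨differentiable_const 0, MemLp.zero⟩
  smul_mem' := fun c _ hf => ⟨hf.1.const_smul c, hf.2.const_smul c⟩

/-- The `p`-Fock space `F_t^p = L^p(ℂⁿ, μ_{2t/p}) ∩ Hol(ℂⁿ)`. -/
def FockSpace (n : ℕ) (p t : ℝ) : Type := fockSubmodule n p t

variable {p t : ℝ}

instance : AddCommGroup (FockSpace n p t) := inferInstanceAs (AddCommGroup (fockSubmodule n p t))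

instance : Module ℂ (FockSpace n p t) := inferInstanceAs (Module ℂ (fockSubmodule n p t))

instance : CoeFun (FockSpace n p t) fun _ => Cn n → ℂ := ⟨fun f => f.1⟩

lemma FockSpace.differentiable (f : FockSpace n p t) : Differentiable ℂ f := f.2.1

lemma FockSpace.memLp (f : FockSpace n p t) :
    MemLp f (ENNReal.ofReal p) (gaussian n (2 * t / p)) := f.2.2

/-- The inclusion of the Fock space into `L^p(μ_{2t/p})`. -/
def FockSpace.toLp : FockSpace n p t →ₗ[ℂ] Lp ℂ (ENNReal.ofReal p) (gaussian n (2 * t / p)) where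
  toFun f := f.memLp.toLp f
  map_add' f g := MemLp.toLp_add f.memLp g.memLp
  map_smul' c f := MemLp.toLp_const_smul c f.memLp

instance [hp : Fact (1 < p)] : Fact (1 ≤ ENNReal.ofReal p) :=
  ⟨by simpa using hp.out.le⟩

lemma FockSpace.toLp_injective [hp : Fact (1 < p)] [ht : Fact (0 < t)] :
    Function.Injective (FockSpace.toLp (n := n) (p := p) (t := t)) := by
  intro f g h
  have hp0 : 0 < p := by have := hp.out; linarith
  have ht0 := ht.out
  have h1 : (f : Cn n → ℂ) =ᵐ[gaussian n (2 * t / p)] g :=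
    (MemLp.toLp_eq_toLp_iff f.memLp g.memLp).mp h
  have h2 : (f : Cn n → ℂ) =ᵐ[volume] g :=
    (absolutelyContinuous_gaussian (by positivity)).ae_eq h1
  exact Subtype.ext
    ((Continuous.ae_eq_iff_eq volume f.differentiable.continuous g.differentiable.continuous).mp h2)

/-- The Fock space carries the norm of `L^p(μ_{2t/p})`. -/
instance [Fact (1 < p)] [Fact (0 < t)] : NormedAddCommGroup (FockSpace n p t) :=
  NormedAddCommGroup.induced _ _ (FockSpace.toLp (n := n) (p := p) (t := t))
    FockSpace.toLp_injective

instance [Fact (1 < p)] [Fact (0 < t)] : NormedSpace ℂ (FockSpace n p t) :=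
  NormedSpace.induced ℂ _ _ (FockSpace.toLp (n := n) (p := p) (t := t))

lemma FockSpace.norm_def [Fact (1 < p)] [Fact (0 < t)] (f : FockSpace n p t) :
    ‖f‖ = (eLpNorm f (ENNReal.ofReal p) (gaussian n (2 * t / p))).toReal :=
  Lp.norm_toLp _ f.memLp

/-! ### Weyl operators -/

section Weyl

lemma herm_add_left (v w z : Cn n) : herm (v + w) z = herm v z + herm w z := by
  simp [herm, add_mul, Finset.sum_add_distrib]

lemma herm_smul_left (c : ℂ) (w z : Cn n) : herm (c • w) z = c * herm w z := by
  simp [herm, Finset.mul_sum, mul_assoc]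

/-- `w ↦ w · \overline z` as a continuous linear functional. -/
def hermCLM (z : Cn n) : Cn n →L[ℂ] ℂ := ∑ i, conj (z i) • ContinuousLinearMap.proj i

lemma hermCLM_apply (z w : Cn n) : hermCLM z w = herm w z := by
  simp [hermCLM, herm, mul_comm]

lemma differentiable_herm (z : Cn n) : Differentiable ℂ fun w => herm w z := by
  have h : (fun w => herm w z) = hermCLM z := funext fun w => (hermCLM_apply z w).symm
  rw [h]
  exact (hermCLM z).differentiable

lemma differentiable_kernelFun (t : ℝ) (z : Cn n) : Differentiable ℂ (kernelFun t z) := by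
  have := differentiable_herm z
  unfold kernelFun
  fun_prop

lemma enorm_kernelFun_mul_weight (ht : 0 < t) (z w : Cn n) :
    ‖kernelFun t z w‖ₑ * weight t w = weight t (w - z) := by
  rw [weight, weight, ← ofReal_norm, kernelFun, Complex.norm_exp,
    ← ENNReal.ofReal_mul (Real.exp_nonneg _), ← Real.exp_add, normSq_sub]
  congr 2
  have : (herm w z / (t : ℂ) - (normSq z : ℂ) / (2 * (t : ℂ))).re =
      (herm w z).re / t - normSq z / (2 * t) := by
    rw [Complex.sub_re, Complex.div_ofReal_re]
    congr 1
    exact_mod_cast Complex.ofReal_re (normSq z / (2 * t))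
  rw [this]
  field_simp
  ring

lemma eLpNorm_weyl (hp : 1 < p) (ht : 0 < t) (z : Cn n) (f : Cn n → ℂ) :
    eLpNorm (fun w => kernelFun t z w * f (w - z)) (ENNReal.ofReal p) (gaussian n (2 * t / p)) =
      eLpNorm f (ENNReal.ofReal p) (gaussian n (2 * t / p)) := by
  rw [eLpNorm_gaussian hp ht, eLpNorm_gaussian hp ht,
    ← lintegral_sub_right_eq_self (fun w => (‖f w‖ₑ * weight t w) ^ p) z]
  congr 2
  refine lintegral_congr fun w => ?_
  rw [enorm_mul, mul_right_comm, enorm_kernelFun_mul_weight ht, mul_comm]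

variable [hp : Fact (1 < p)] [ht : Fact (0 < t)]

/-- The Weyl operator `(W_z f)(w) = k_z^t(w) f(w - z)` on `F_t^p`. -/
def weyl (z : Cn n) : FockSpace n p t →L[ℂ] FockSpace n p t :=
  LinearMap.mkContinuous
    { toFun := fun f => ⟨fun w => kernelFun t z w * f (w - z),
        (differentiable_kernelFun t z).mul (f.differentiable.comp (by fun_prop)),
        ((differentiable_kernelFun t z).mul
          (f.differentiable.comp (by fun_prop))).continuous.aestronglyMeasurable,
        by rw [eLpNorm_weyl hp.out ht.out]; exact f.memLp.2⟩
      map_add' := fun f g => Subtype.ext (funext fun w => mul_add _ _ _)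
      map_smul' := fun c f => Subtype.ext (funext fun w => mul_left_comm _ _ _) }
    1 (fun f => by
      rw [one_mul, FockSpace.norm_def, FockSpace.norm_def]
      exact (congrArg ENNReal.toReal (eLpNorm_weyl hp.out ht.out z f)).le)

@[simp]
lemma weyl_apply (z : Cn n) (f : FockSpace n p t) (w : Cn n) :
    weyl z f w = kernelFun t z w * f (w - z) := rfl

/-- The action `α_z(A) = W_z A W_{-z}` on operators. -/
def shiftOp (z : Cn n) (A : FockSpace n p t →L[ℂ] FockSpace n p t) :
    FockSpace n p t →L[ℂ] FockSpace n p t :=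
  weyl z ∘L A ∘L weyl (-z)

end Weyl

/-! ### Toeplitz operators -/

section Toeplitz

lemma memLp_bdd_mul {f h : Cn n → ℂ} (hf : MemLp f ∞ volume)
    (hh : MemLp h (ENNReal.ofReal p) (gaussian n (2 * t / p))) :
    MemLp (fun w => f w * h w) (ENNReal.ofReal p) (gaussian n (2 * t / p)) := by
  have hf' : MemLp f ∞ (gaussian n (2 * t / p)) :=
    ⟨hf.1.mono_ac (gaussian_absolutelyContinuous _),
      (eLpNormEssSup_mono_measure f (gaussian_absolutelyContinuous _)).trans_lt
        (by simpa using hf.2)⟩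
  exact hh.mul hf'

lemma integrable_bergman (hp : 1 < p) (ht : 0 < t) {h : Cn n → ℂ}
    (hh : MemLp h (ENNReal.ofReal p) (gaussian n (2 * t / p))) (z : Cn n) :
    Integrable (fun w => Complex.exp (herm z w / (t : ℂ)) * h w) (gaussian n t) := by
  have hmeas : AEStronglyMeasurable h (gaussian n t) :=
    (hh.1.mono_ac (absolutelyContinuous_gaussian (by positivity))).mono_ac
      (gaussian_absolutelyContinuous t)
  refine (integrable_exp_mul hp ht hh (‖z‖ / t)).mono' ?_ ?_
  · refine AEStronglyMeasurable.mul (Continuous.aestronglyMeasurable ?_) hmeas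
    unfold herm
    fun_prop
  · filter_upwards with w
    rw [norm_mul, Complex.norm_exp]
    gcongr
    rw [Complex.div_ofReal_re, div_mul_eq_mul_div]
    gcongr
    exact (Complex.re_le_norm _).trans (norm_herm_le z w)

lemma norm_hermCLM_le (w : Cn n) : ‖hermCLM w‖ ≤ ∑ i, ‖w i‖ := by
  refine ContinuousLinearMap.opNorm_le_bound _ (by positivity) fun z => ?_
  rw [hermCLM_apply, mul_comm]
  exact norm_herm_le z w

lemma differentiable_bergmanProj (hp : 1 < p) (ht : 0 < t) {h : Cn n → ℂ}
    (hh : MemLp h (ENNReal.ofReal p) (gaussian n (2 * t / p))) :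
    Differentiable ℂ (bergmanProj t h) := by
  intro z₀
  have hmeas : AEStronglyMeasurable h (gaussian n t) :=
    (hh.1.mono_ac (absolutelyContinuous_gaussian (by positivity))).mono_ac
      (gaussian_absolutelyContinuous t)
  have hcont : ∀ z : Cn n, Continuous fun w : Cn n => Complex.exp (herm z w / (t : ℂ)) := by
    intro z
    unfold herm
    fun_prop
  let F' : Cn n → Cn n → Cn n →L[ℂ] ℂ := fun z w =>
    (h w * Complex.exp (herm z w / (t : ℂ)) * (1 / (t : ℂ))) • hermCLM w
  have key := hasFDerivAt_integral_of_dominated_of_fderiv_le (𝕜 := ℂ) (μ := gaussian n t)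
    (F := fun z w => Complex.exp (herm z w / (t : ℂ)) * h w) (F' := F') (x₀ := z₀)
    (bound := fun w => 1 / t * (Real.exp (((‖z₀‖ + 1) / t + 1) * ∑ i, ‖w i‖) * ‖h w‖))
    (Metric.ball_mem_nhds z₀ one_pos)
    (Filter.Eventually.of_forall fun z => (hcont z).aestronglyMeasurable.mul hmeas)
    (integrable_bergman hp ht hh z₀) ?_ ?_ ((integrable_exp_mul hp ht hh _).const_mul _) ?_
  · exact key.differentiableAt
  · refine AEStronglyMeasurable.smul ((hmeas.mul (hcont z₀).aestronglyMeasurable).mul_const _)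
      (Continuous.aestronglyMeasurable ?_)
    unfold hermCLM
    fun_prop
  · filter_upwards with w z hz
    have hz' : ‖z‖ ≤ ‖z₀‖ + 1 := by
      have := norm_le_norm_add_norm_sub' z z₀
      have h2 : ‖z - z₀‖ < 1 := by simpa [dist_eq_norm] using hz
      linarith
    set s := ∑ i, ‖w i‖ with hs
    have hs0 : 0 ≤ s := by positivity
    have h1 : ‖Complex.exp (herm z w / (t : ℂ))‖ ≤ Real.exp ((‖z₀‖ + 1) / t * s) := by
      rw [Complex.norm_exp, Complex.div_ofReal_re, div_mul_eq_mul_div]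
      gcongr
      refine (Complex.re_le_norm _).trans ((norm_herm_le z w).trans ?_)
      gcongr
    have h2 : ‖hermCLM w‖ ≤ Real.exp s :=
      (norm_hermCLM_le w).trans (by linarith [Real.add_one_le_exp s])
    have h3 : ‖(1 / (t : ℂ))‖ = 1 / t := by simp [abs_of_pos ht]
    calc ‖F' z w‖ = ‖h w‖ * ‖Complex.exp (herm z w / (t : ℂ))‖ * (1 / t) * ‖hermCLM w‖ := by
          simp only [F', norm_smul, norm_mul, h3]
      _ ≤ ‖h w‖ * Real.exp ((‖z₀‖ + 1) / t * s) * (1 / t) * Real.exp s := by gcongr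
      _ = _ := by rw [add_mul, one_mul, Real.exp_add]; ring
  · filter_upwards with w z _
    have h1 : HasFDerivAt (fun z => herm z w) (hermCLM w) z := by
      have h : (fun z => herm z w) = hermCLM w := funext fun z => (hermCLM_apply w z).symm
      rw [h]
      exact (hermCLM w).hasFDerivAt
    have h2 := ((h1.mul_const (1 / (t : ℂ))).cexp).mul_const (h w)
    convert! h2 using 1
    · ext z
      simp [div_eq_mul_inv]
    · simp only [F', smul_smul]
      congr 1
      simp only [div_eq_mul_inv, one_mul]
      ring

/-- Young's inequality for nonnegative kernels. -/
lemma lintegral_young (hp : 1 < p) {κ H : Cn n → ℝ≥0∞} (hκ : Measurable κ)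
    (hH : AEMeasurable H volume) :
    ∫⁻ z, (∫⁻ w, κ (z - w) * H w) ^ p ≤ (∫⁻ w, κ w) ^ p * ∫⁻ w, H w ^ p := by
  have hp0 : 0 < p := by linarith
  have hpq : p.HolderConjugate (p.conjExponent) := Real.HolderConjugate.conjExponent hp
  set q := p.conjExponent with hq
  have hq0 : 0 < q := hpq.symm.pos
  have hsub : ∀ z : Cn n, ∫⁻ w, κ (z - w) = ∫⁻ w, κ w := fun z =>
    lintegral_sub_left_eq_self κ z
  have hκz : ∀ z : Cn n, Measurable fun w => κ (z - w) := fun z => by fun_prop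
  have hsum : 1 / p + 1 / q = 1 := by
    simpa using hpq.inv_add_inv_eq_one
  have hpt : ∀ z : Cn n, (∫⁻ w, κ (z - w) * H w) ^ p ≤
      (∫⁻ w, κ w) ^ (p / q) * ∫⁻ w, κ (z - w) * H w ^ p := by
    intro z
    have h1 := ENNReal.lintegral_mul_le_Lp_mul_Lq (volume : Measure (Cn n)) hpq
      (f := fun w => κ (z - w) ^ (1 / p) * H w) (g := fun w => κ (z - w) ^ (1 / q))
      (((hκz z).pow_const _).aemeasurable.mul hH) ((hκz z).pow_const _).aemeasurable
    have e1 : ∀ w, ((fun w => κ (z - w) ^ (1 / p) * H w) * fun w => κ (z - w) ^ (1 / q)) w =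
        κ (z - w) * H w := by
      intro w
      simp only [Pi.mul_apply]
      rw [mul_right_comm, ← ENNReal.rpow_add_of_nonneg _ _ (by positivity) (by positivity), hsum,
        ENNReal.rpow_one]
    have e2 : ∀ w, (κ (z - w) ^ (1 / p) * H w) ^ p = κ (z - w) * H w ^ p := by
      intro w
      rw [ENNReal.mul_rpow_of_nonneg _ _ hp0.le, ← ENNReal.rpow_mul, one_div_mul_cancel hp0.ne',
        ENNReal.rpow_one]
    have e3 : ∀ w, (κ (z - w) ^ (1 / q)) ^ q = κ (z - w) := by
      intro w
      rw [← ENNReal.rpow_mul, one_div_mul_cancel hq0.ne', ENNReal.rpow_one]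
    simp only [e1, e2, e3, hsub] at h1
    calc (∫⁻ w, κ (z - w) * H w) ^ p
        ≤ ((∫⁻ w, κ (z - w) * H w ^ p) ^ (1 / p) * (∫⁻ w, κ w) ^ (1 / q)) ^ p := by gcongr
      _ = _ := by
        rw [ENNReal.mul_rpow_of_nonneg _ _ hp0.le, ← ENNReal.rpow_mul, ← ENNReal.rpow_mul,
          one_div_mul_cancel hp0.ne', ENNReal.rpow_one, mul_comm]
        congr 2
        ring
  have hpow : (∫⁻ w, κ w) ^ (p / q) * ∫⁻ w, κ w = (∫⁻ w, κ w) ^ p := by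
    conv_lhs => rw [← ENNReal.rpow_one (∫⁻ w, κ w), ← ENNReal.rpow_mul, one_mul]
    rw [← ENNReal.rpow_add_of_nonneg _ _ (by positivity) zero_le_one]
    congr 1
    have := congrArg (p * ·) hsum
    simp only [mul_add, mul_one_div, div_self hp0.ne', mul_one] at this
    linarith
  have hint : AEMeasurable (fun x : Cn n × Cn n => κ (x.1 - x.2) * H x.2 ^ p)
      (volume.prod volume) := by
    refine AEMeasurable.mul (by fun_prop) ?_
    exact (hH.pow_const p).comp_quasiMeasurePreserving Measure.quasiMeasurePreserving_snd
  calc ∫⁻ z, (∫⁻ w, κ (z - w) * H w) ^ p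
      ≤ ∫⁻ z, (∫⁻ w, κ w) ^ (p / q) * ∫⁻ w, κ (z - w) * H w ^ p := lintegral_mono hpt
    _ = (∫⁻ w, κ w) ^ (p / q) * ∫⁻ z, ∫⁻ w, κ (z - w) * H w ^ p := by
        refine lintegral_const_mul'' _ ?_
        exact hint.lintegral_prod_right'
    _ = (∫⁻ w, κ w) ^ (p / q) * ∫⁻ w, ∫⁻ z, κ (z - w) * H w ^ p := by
        rw [lintegral_lintegral_swap hint]
    _ = (∫⁻ w, κ w) ^ (p / q) * ∫⁻ w, (∫⁻ w, κ w) * H w ^ p := by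
        congr 1
        refine lintegral_congr fun w => ?_
        rw [lintegral_mul_const _ (by fun_prop), lintegral_sub_right_eq_self κ w]
    _ = _ := by
        rw [lintegral_const_mul'' _ (hH.pow_const p), ← mul_assoc, hpow]

lemma enorm_bergmanProj_le (ht : 0 < t) (h : Cn n → ℂ) (z : Cn n) :
    ‖bergmanProj t h z‖ₑ * weight t z ≤
      gconst n t * ∫⁻ w, weight t (z - w) * (‖h w‖ₑ * weight t w) := by
  have h1 : ‖bergmanProj t h z‖ₑ ≤ _ := enorm_integral_le_lintegral_enorm _
  rw [lintegral_gaussian ht] at h1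
  calc ‖bergmanProj t h z‖ₑ * weight t z ≤ _ := mul_le_mul_left h1 (weight t z)
    _ = _ := by
      rw [mul_assoc, ← lintegral_mul_const' _ _ (by exact ENNReal.ofReal_ne_top)]
      congr 1
      refine lintegral_congr fun w => ?_
      simp only [weight, enorm_mul]
      rw [← ofReal_norm (Complex.exp _), Complex.norm_exp, Complex.div_ofReal_re, normSq_sub]
      have e : ∀ a b c : ℝ, ENNReal.ofReal (Real.exp a) * ‖h w‖ₑ * ENNReal.ofReal (Real.exp b) *
          ENNReal.ofReal (Real.exp c) = ‖h w‖ₑ * ENNReal.ofReal (Real.exp (a + b + c)) := by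
        intro a b c
        rw [Real.exp_add, Real.exp_add, ENNReal.ofReal_mul (by positivity),
          ENNReal.ofReal_mul (by positivity)]
        ring
      have e' : ∀ a b : ℝ, ENNReal.ofReal (Real.exp a) * (‖h w‖ₑ * ENNReal.ofReal (Real.exp b)) =
          ‖h w‖ₑ * ENNReal.ofReal (Real.exp (a + b)) := by
        intro a b
        rw [Real.exp_add, ENNReal.ofReal_mul (by positivity)]
        ring
      rw [e, e']
      congr 3
      field_simp
      ring

/-- The norm bound for `P_t` on `L^p(μ_{2t/p})`. -/
def projBound (n : ℕ) (t : ℝ) : ℝ≥0∞ := gconst n t * ∫⁻ w : Cn n, weight t w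

lemma projBound_lt_top (ht : 0 < t) : projBound n t < ∞ := by
  refine ENNReal.mul_lt_top (gconst_ne_top t).lt_top ?_
  have := lintegral_exp_lt_top (n := n) (c := 1 / (2 * t)) (by positivity) 0
  convert! this using 3 with w
  rw [weight]
  congr 2
  field_simp
  ring

lemma eLpNorm_bergmanProj_le (hp : 1 < p) (ht : 0 < t) {h : Cn n → ℂ}
    (hh : MemLp h (ENNReal.ofReal p) (gaussian n (2 * t / p))) :
    eLpNorm (bergmanProj t h) (ENNReal.ofReal p) (gaussian n (2 * t / p)) ≤
      projBound n t * eLpNorm h (ENNReal.ofReal p) (gaussian n (2 * t / p)) := by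
  have hp0 : 0 < p := by linarith
  have hvol : AEStronglyMeasurable h volume :=
    hh.1.mono_ac (absolutelyContinuous_gaussian (by positivity))
  rw [eLpNorm_gaussian hp ht, eLpNorm_gaussian hp ht]
  have e : projBound n t = (projBound n t ^ p) ^ (1 / p) := by
    rw [← ENNReal.rpow_mul, mul_one_div_cancel hp0.ne', ENNReal.rpow_one]
  rw [e, ← ENNReal.mul_rpow_of_nonneg _ _ (by positivity)]
  refine ENNReal.rpow_le_rpow ?_ (by positivity)
  rw [mul_left_comm]
  refine mul_le_mul_right ?_ _
  calc ∫⁻ z, (‖bergmanProj t h z‖ₑ * weight t z) ^ p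
      ≤ ∫⁻ z, (gconst n t * ∫⁻ w, weight t (z - w) * (‖h w‖ₑ * weight t w)) ^ p := by
        refine lintegral_mono fun z => ?_
        have := enorm_bergmanProj_le ht h z
        gcongr
    _ = gconst n t ^ p * ∫⁻ z, (∫⁻ w, weight t (z - w) * (‖h w‖ₑ * weight t w)) ^ p := by
        simp_rw [ENNReal.mul_rpow_of_nonneg _ _ hp0.le]
        exact lintegral_const_mul' _ _
          (ENNReal.rpow_ne_top_of_nonneg hp0.le (gconst_ne_top t))
    _ ≤ gconst n t ^ p * ((∫⁻ w : Cn n, weight t w) ^ p *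
          ∫⁻ w, (‖h w‖ₑ * weight t w) ^ p) := by
        gcongr
        exact lintegral_young hp (measurable_weight t)
          (hvol.enorm.mul (measurable_weight t).aemeasurable)
    _ = _ := by
        rw [projBound, ENNReal.mul_rpow_of_nonneg _ _ hp0.le, mul_assoc]

lemma eLpNorm_bdd_mul_le {f : Cn n → ℂ} (h : Cn n → ℂ)
    (hh : AEStronglyMeasurable h (gaussian n (2 * t / p))) :
    eLpNorm (fun w => f w * h w) (ENNReal.ofReal p) (gaussian n (2 * t / p)) ≤
      eLpNorm f ∞ volume * eLpNorm h (ENNReal.ofReal p) (gaussian n (2 * t / p)) := by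
  have h1 := eLpNorm_le_eLpNorm_top_mul_eLpNorm (μ := gaussian n (2 * t / p))
    (ENNReal.ofReal p) f hh (fun a b => a * b) 1 (by simp)
  have h2 : eLpNorm f ∞ (gaussian n (2 * t / p)) ≤ eLpNorm f ∞ volume := by
    simpa using eLpNormEssSup_mono_measure f (gaussian_absolutelyContinuous (2 * t / p))
  refine h1.trans ?_
  simp only [ENNReal.coe_one, one_mul]
  gcongr

variable [hp : Fact (1 < p)] [ht : Fact (0 < t)]

/-- The Toeplitz operator `T_f^t g = P_t(f g)` on `F_t^p` with symbol `f ∈ L^∞(ℂⁿ)`. -/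
def toeplitz (f : Cn n → ℂ) (hf : MemLp f ∞ volume) : FockSpace n p t →L[ℂ] FockSpace n p t :=
  LinearMap.mkContinuous
    { toFun := fun g => ⟨bergmanProj t fun w => f w * g w,
        differentiable_bergmanProj hp.out ht.out (memLp_bdd_mul hf g.memLp),
        (differentiable_bergmanProj hp.out ht.out
          (memLp_bdd_mul hf g.memLp)).continuous.aestronglyMeasurable,
        (eLpNorm_bergmanProj_le hp.out ht.out
          (memLp_bdd_mul hf g.memLp)).trans_lt
            (ENNReal.mul_lt_top (projBound_lt_top ht.out)
              (memLp_bdd_mul hf g.memLp).2)⟩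
      map_add' := fun g h => Subtype.ext (funext fun z => by
        have hg := integrable_bergman hp.out ht.out (memLp_bdd_mul hf g.memLp) z
        have hh := integrable_bergman hp.out ht.out (memLp_bdd_mul hf h.memLp) z
        refine Eq.trans ?_ (integral_add hg hh)
        refine integral_congr_ae (Filter.Eventually.of_forall fun w => ?_)
        change _ * (f w * (g w + h w)) = _ * (f w * g w) + _ * (f w * h w)
        ring)
      map_smul' := fun c g => Subtype.ext (funext fun z => by
        refine Eq.trans ?_ (integral_const_mul c _)
        refine integral_congr_ae (Filter.Eventually.of_forall fun w => ?_)
        change _ * (f w * (c * g w)) = c * (_ * (f w * g w))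
        ring) }
    (projBound n t * eLpNorm f ∞ volume).toReal (fun g => by
      rw [FockSpace.norm_def, FockSpace.norm_def, ← ENNReal.toReal_mul]
      refine ENNReal.toReal_mono (ENNReal.mul_lt_top (ENNReal.mul_lt_top (projBound_lt_top ht.out)
        hf.2) g.memLp.2).ne ?_
      refine (eLpNorm_bergmanProj_le hp.out ht.out
        (memLp_bdd_mul hf g.memLp)).trans ?_
      rw [mul_assoc]
      gcongr
      exact eLpNorm_bdd_mul_le g g.memLp.1)

@[simp]
lemma toeplitz_apply (f : Cn n → ℂ) (hf : MemLp f ∞ volume) (g : FockSpace n p t) (z : Cn n) :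
    toeplitz f hf g z = bergmanProj t (fun w => f w * g w) z := rfl

variable (p t) in
/-- The Toeplitz operators on `F_t^p` with symbols in `𝒟 ⊆ L^∞(ℂⁿ)`. -/
def toeplitzSet (𝒟 : Set (Cn n → ℂ)) : Set (FockSpace n p t →L[ℂ] FockSpace n p t) :=
  {T | ∃ f ∈ 𝒟, ∃ hf : MemLp f ∞ volume, T = toeplitz f hf}

variable (p t) in
/-- `𝒯_lin^{p,t}(𝒟)`: the closed linear span of the Toeplitz operators with symbols in `𝒟`. -/
def toeplitzLin (𝒟 : Set (Cn n → ℂ)) :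
    Submodule ℂ (FockSpace n p t →L[ℂ] FockSpace n p t) :=
  (Submodule.span ℂ (toeplitzSet p t 𝒟)).topologicalClosure

variable (p t) in
/-- `𝒯^{p,t}(𝒟)`: the Banach algebra generated by the Toeplitz operators with symbols
in `𝒟`. -/
def toeplitzAlg (𝒟 : Set (Cn n → ℂ)) :
    NonUnitalSubalgebra ℂ (FockSpace n p t →L[ℂ] FockSpace n p t) :=
  (NonUnitalAlgebra.adjoin ℂ (toeplitzSet p t 𝒟)).topologicalClosure

variable (n p t) in
/-- The full Toeplitz algebra `𝒯^{p,t} = 𝒯^{p,t}(L^∞(ℂⁿ))`. -/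
def fullToeplitzAlg : NonUnitalSubalgebra ℂ (FockSpace n p t →L[ℂ] FockSpace n p t) :=
  toeplitzAlg p t {f | MemLp f ∞ volume}

end Toeplitz

/-! ### Berezin transform -/

section Berezin

variable [hp : Fact (1 < p)] [ht : Fact (0 < t)]

/-- The normalized reproducing kernel `k_z^t` as an element of `F_t^p`. -/
def fockKernel (z : Cn n) : FockSpace n p t :=
  ⟨kernelFun t z, differentiable_kernelFun t z, by
    have hp1 := hp.out
    have ht1 := ht.out
    have hp0 : 0 < p := by linarith
    have h1 : eLpNorm (fun _ : Cn n => (1 : ℂ)) (ENNReal.ofReal p) (gaussian n (2 * t / p)) < ∞ := by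
      rw [eLpNorm_gaussian hp1 ht1]
      refine ENNReal.rpow_lt_top_of_nonneg (by positivity)
        (ENNReal.mul_lt_top (gconst_ne_top _).lt_top ?_).ne
      have := lintegral_exp_lt_top (n := n) (c := 1 / (2 * t) * p) (by positivity) 0
      convert! this using 3 with w
      rw [weight, enorm_one, one_mul, ENNReal.ofReal_rpow_of_pos (Real.exp_pos _), ← Real.exp_mul]
      congr 2
      ring
    refine ⟨(differentiable_kernelFun t z).continuous.aestronglyMeasurable, ?_⟩
    rw [← eLpNorm_weyl hp1 ht1 z] at h1
    simpa using h1⟩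

@[simp]
lemma fockKernel_apply (z w : Cn n) : (fockKernel z : FockSpace n p t) w = kernelFun t z w := rfl

/-- The Berezin transform `Ã(z) = ⟨A k_z^t, k_z^t⟩ = ∫ (A k_z^t)(w) \overline{k_z^t(w)} dμ_t(w)`. -/
def berezin (A : FockSpace n p t →L[ℂ] FockSpace n p t) (z : Cn n) : ℂ :=
  ∫ w, A (fockKernel z) w * conj (kernelFun t z w) ∂(gaussian n t)

/-- The closed linear span, in the space of bounded continuous functions with the supremum norm,
of the Berezin transforms of the operators in `𝒮`. -/
def berezinSpan (𝒮 : Set (FockSpace n p t →L[ℂ] FockSpace n p t)) :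
    Submodule ℂ (Cn n →ᵇ ℂ) :=
  (Submodule.span ℂ {g : Cn n →ᵇ ℂ | ∃ A ∈ 𝒮, (g : Cn n → ℂ) = berezin A}).topologicalClosure

end Berezin

/-! ### Symbol spaces -/

/-- `BUC(ℂⁿ)`, the bounded uniformly continuous functions, inside the bounded continuous ones. -/
def BUC (n : ℕ) : Submodule ℂ (Cn n →ᵇ ℂ) where
  carrier := {f | UniformContinuous f}
  add_mem' := fun hf hg => UniformContinuous.add hf hg
  zero_mem' := uniformContinuous_const
  smul_mem' := fun c _ hf => UniformContinuous.const_smul hf c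

/-- The translate `α_z(f)(w) = f(w - z)`. -/
def shiftFun (z : Cn n) (f : Cn n →ᵇ ℂ) : Cn n →ᵇ ℂ :=
  f.compContinuous ⟨fun w => w - z, by fun_prop⟩

/-- `𝒟₀` is a closed `α`-invariant subspace of `BUC(ℂⁿ)`. -/
structure IsClosedInvariantBUC (𝒟₀ : Submodule ℂ (Cn n →ᵇ ℂ)) : Prop where
  le_BUC : 𝒟₀ ≤ BUC n
  isClosed : IsClosed (𝒟₀ : Set (Cn n →ᵇ ℂ))
  shift_mem : ∀ z : Cn n, ∀ f ∈ 𝒟₀, shiftFun z f ∈ 𝒟₀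

/-- A space of bounded continuous functions, as a set of symbols in `L^∞(ℂⁿ)`. -/
def symbols (𝒟₀ : Submodule ℂ (Cn n →ᵇ ℂ)) : Set (Cn n → ℂ) :=
  (fun f : Cn n →ᵇ ℂ => (f : Cn n → ℂ)) '' 𝒟₀

end Fock

end

/-! Write `T f` for the Toeplitz operator with symbol `f`. Quantization `f ↦ T f` and the Berezin
transform `A ↦ Ã` both intertwine translation of functions with the action `α`, and either composite
is a Gaussian average over an orbit: `T Ã = ∫ α_z(A) dμ_t(z)` (`toeplitz_berezin`), and the Berezin
transform of `T f` is `∫ α_z(f) dμ_t(z)` (`berezinBCF_toeplitz`). The theorem says that such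
averages neither leave a closed invariant subspace nor lose information about it.

Not leaving is Hahn–Banach: a functional that vanishes on the subspace passes through the integral
(`integral_gaussian_mem`). Not losing is Tauberian (`apply_zero_mem_of_integral_gaussian_mem`): if
every average of a bounded continuous orbit `u`, started at any `w`, lies in a closed subspace `S`,
then `u 0 ∈ S`. Indeed, for `l` vanishing on `S`, the scalar function `l ∘ u` has zero Gaussian
convolution, and this convolution is injective on bounded continuous functions
(`eq_zero_of_gaussian_convolution`), because exponential moments determine a finite measure.

With `D` the closed span of the Berezin transforms of `𝒮`, the first fact gives `T D ⊆ 𝒮` and the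
second gives `𝒮` inside the closed span of `T D`. Uniqueness is the same pair of arguments with the
roles of functions and operators exchanged.

Two analytic inputs remain. Orbits must be norm continuous: the operators with this property form a
closed algebra, and Toeplitz operators belong to it because `‖α_z(T f) - T f‖ = O(‖z‖)` even for
discontinuous `f`. And the formula for `T Ã` is checked on Berezin transforms, which needs their
injectivity: `(B K_a)(b)` is antiholomorphic in `a` and holomorphic in `b`, so its diagonal
determines it, and the kernels `K_a` span a dense subspace. -/

noncomputable section

namespace Fock

variable {n : ℕ} {p t : ℝ}

/-! ### Gaussian integrals -/

/-- The density of `μ_s` with respect to Lebesgue measure. -/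
def gaussianDensity (n : ℕ) (s : ℝ) (z : Cn n) : ℝ :=
  1 / (Real.pi * s) ^ n * Real.exp (-normSq z / s)

lemma gaussianDensity_nonneg {s : ℝ} (hs : 0 < s) (z : Cn n) : 0 ≤ gaussianDensity n s z := by
  have := Real.pi_pos
  unfold gaussianDensity
  positivity

lemma continuous_gaussianDensity (s : ℝ) : Continuous (gaussianDensity n s) := by
  have := continuous_normSq (n := n)
  unfold gaussianDensity
  fun_prop

lemma gaussian_eq_withDensity (n : ℕ) (s : ℝ) :
    gaussian n s = volume.withDensity fun z => ENNReal.ofReal (gaussianDensity n s z) := rfl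

lemma integral_gaussian {E : Type*} [NormedAddCommGroup E] [NormedSpace ℝ E] {s : ℝ} (hs : 0 < s)
    (h : Cn n → E) : ∫ w, h w ∂(gaussian n s) = ∫ w, gaussianDensity n s w • h w := by
  rw [gaussian_eq_withDensity, integral_withDensity_eq_integral_toReal_smul
    (continuous_gaussianDensity s).measurable.ennreal_ofReal
    (Filter.Eventually.of_forall fun _ => ENNReal.ofReal_lt_top)]
  refine integral_congr_ae (Filter.Eventually.of_forall fun w => ?_)
  simp only [ENNReal.toReal_ofReal (gaussianDensity_nonneg hs w)]

lemma integrable_gaussian_iff {E : Type*} [NormedAddCommGroup E] [NormedSpace ℝ E] {s : ℝ}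
    (hs : 0 < s) {h : Cn n → E} :
    Integrable h (gaussian n s) ↔ Integrable fun w => gaussianDensity n s w • h w := by
  rw [gaussian_eq_withDensity, integrable_withDensity_iff_integrable_smul'
    (continuous_gaussianDensity s).measurable.ennreal_ofReal
    (Filter.Eventually.of_forall fun _ => ENNReal.ofReal_lt_top)]
  refine integrable_congr (Filter.Eventually.of_forall fun w => ?_)
  simp only [ENNReal.toReal_ofReal (gaussianDensity_nonneg hs w)]

lemma integral_exp_neg_normSq {s : ℝ} (hs : 0 < s) :
    ∫ w : Cn n, Real.exp (-normSq w / s) = (Real.pi * s) ^ n := by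
  have h1 : ∫ x : ℂ, Real.exp (-(1 / s) * ‖x‖ ^ 2) = Real.pi * s := by
    rw [GaussianFourier.integral_rexp_neg_mul_sq_norm (by positivity)]
    simp
  have h2 := integral_fintype_prod_eq_prod (ι := Fin n) (𝕜 := ℝ)
    (fun _ (x : ℂ) => Real.exp (-(1 / s) * ‖x‖ ^ 2)) (μ := fun _ => volume)
  simp only [h1, Finset.prod_const, Finset.card_univ, Fintype.card_fin] at h2
  rw [← h2]
  refine integral_congr_ae (Filter.Eventually.of_forall fun w => ?_)
  simp only [← Real.exp_sum, normSq, ← Finset.mul_sum]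
  congr 1
  ring

lemma isProbabilityMeasure_gaussian {s : ℝ} (hs : 0 < s) :
    IsProbabilityMeasure (gaussian n s) := by
  have hpi := Real.pi_pos
  refine ⟨?_⟩
  have hi : Integrable fun w : Cn n => Real.exp (-normSq w / s) := by
    convert! integrable_exp_neg_normSq (n := n) (c := 1 / s) (by positivity) using 3
    ring
  rw [← lintegral_one, lintegral_gaussian hs]
  simp only [one_mul]
  rw [← ofReal_integral_eq_lintegral_ofReal hi
    (Filter.Eventually.of_forall fun _ => (Real.exp_pos _).le), integral_exp_neg_normSq hs, gconst,
    ← ENNReal.ofReal_mul (by positivity), one_div_mul_cancel (by positivity), ENNReal.ofReal_one]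

/-! ### Identities for the Hermitian form; translating Gaussian integrals -/

lemma normSq_add (w z : Cn n) : normSq (w + z) = normSq w + 2 * (herm w z).re + normSq z := by
  have := normSq_sub w (-z)
  have h : herm w (-z) = -herm w z := by simp [herm]
  rw [sub_neg_eq_add, normSq_neg, h, Complex.neg_re] at this
  linarith

lemma conj_herm (w z : Cn n) : conj (herm w z) = herm z w := by
  simp [herm, mul_comm]

lemma herm_add_right (v w z : Cn n) : herm v (w + z) = herm v w + herm v z := by
  simp [herm, mul_add, Finset.sum_add_distrib]

lemma herm_sub_right (v w z : Cn n) : herm v (w - z) = herm v w - herm v z := by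
  simp [herm, mul_sub, Finset.sum_sub_distrib]

lemma herm_sub_left (v w z : Cn n) : herm (v - w) z = herm v z - herm w z := by
  simp [herm, sub_mul, Finset.sum_sub_distrib]

lemma herm_neg_right (w z : Cn n) : herm w (-z) = -herm w z := by simp [herm]

lemma herm_neg_left (w z : Cn n) : herm (-w) z = -herm w z := by simp [herm]

lemma herm_self (z : Cn n) : herm z z = (normSq z : ℂ) := by
  simp [herm, normSq, Complex.mul_conj, Complex.normSq_eq_norm_sq]

lemma gaussianDensity_add {s : ℝ} (w x : Cn n) :
    gaussianDensity n s (w + x) =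
      gaussianDensity n s w * Real.exp (-(2 * (herm w x).re + normSq x) / s) := by
  unfold gaussianDensity
  rw [mul_assoc, ← Real.exp_add, normSq_add]
  congr 2
  ring

lemma integral_gaussian_add {E : Type*} [NormedAddCommGroup E] [NormedSpace ℝ E] {s : ℝ}
    (hs : 0 < s) (h : Cn n → E) (x : Cn n) :
    ∫ w, h w ∂(gaussian n s) =
      ∫ w, Real.exp (-(2 * (herm w x).re + normSq x) / s) • h (w + x) ∂(gaussian n s) := by
  rw [integral_gaussian hs, integral_gaussian hs,
    ← integral_add_right_eq_self (fun w => gaussianDensity n s w • h w) x]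
  simp only [gaussianDensity_add, mul_smul]

lemma integrable_gaussian_add {E : Type*} [NormedAddCommGroup E] [NormedSpace ℝ E] {s : ℝ}
    (hs : 0 < s) {h : Cn n → E} (x : Cn n) (hh : Integrable h (gaussian n s)) :
    Integrable (fun w => Real.exp (-(2 * (herm w x).re + normSq x) / s) • h (w + x))
      (gaussian n s) := by
  rw [integrable_gaussian_iff hs] at hh ⊢
  simpa only [gaussianDensity_add, mul_smul] using hh.comp_add_right x

/-! ### The mean value property -/

lemma measurePreserving_circle_smul {s : ℝ} (c : Circle) :
    MeasurePreserving (fun w : Cn n => (c : ℂ) • w) (gaussian n s) (gaussian n s) := by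
  have hv : MeasurePreserving (fun w : Cn n => (c : ℂ) • w) volume volume := by
    have := volume_preserving_pi (ι := Fin n) (f := fun _ => rotation c)
      fun _ => (rotation c).measurePreserving
    convert! this using 3
  refine ⟨hv.measurable, ?_⟩
  ext A hA
  have hN : ∀ w : Cn n, normSq ((c : ℂ) • w) = normSq w := fun w => by simp [normSq, Circle.norm_coe]
  have hm := (continuous_gaussianDensity (n := n) s).measurable.ennreal_ofReal
  rw [Measure.map_apply hv.measurable hA, gaussian_eq_withDensity,
    withDensity_apply _ (hv.measurable hA), withDensity_apply _ hA,
    ← hv.setLIntegral_comp_preimage hA hm]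
  simp only [gaussianDensity, hN]

/-- The measure is invariant under `w ↦ e^{iθ} w`, so by Fubini `h` may be replaced by its mean over
each circle `θ ↦ e^{iθ} w`. That mean is `h 0`, by the one-variable mean value property of `ζ ↦ h (ζ
• w)`. -/
lemma integral_gaussian_of_differentiable {s : ℝ} (hs : 0 < s) {h : Cn n → ℂ}
    (hd : Differentiable ℂ h) (hi : Integrable h (gaussian n s)) :
    ∫ w, h w ∂(gaussian n s) = h 0 := by
  have := isProbabilityMeasure_gaussian (n := n) hs
  have hpi := Real.pi_pos
  have hcm : ∀ θ : ℝ, circleMap 0 1 θ = (Circle.exp θ : ℂ) := fun θ => by simp [circleMap]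
  have hrot : ∀ θ : ℝ, ∫ w, h (circleMap 0 1 θ • w) ∂(gaussian n s) =
      ∫ w, h w ∂(gaussian n s) := fun θ => by
    have hmp := measurePreserving_circle_smul (n := n) (s := s) (Circle.exp θ)
    rw [hcm]
    conv_rhs => rw [← hmp.map_eq]
    rw [integral_map hmp.measurable.aemeasurable
      hd.continuous.aestronglyMeasurable]
  have hmean : ∀ w : Cn n, ∫ θ in (0 : ℝ)..2 * Real.pi, h (circleMap 0 1 θ • w) =
      (2 * Real.pi) • h 0 := fun w => by
    have hdw : Differentiable ℂ fun ζ : ℂ => h (ζ • w) := hd.comp (by fun_prop)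
    have := (hdw.diffContOnCl (s := Metric.ball 0 |1|)).circleAverage
    rw [Real.circleAverage_def, zero_smul] at this
    rw [← this, smul_smul, mul_inv_cancel₀ (by positivity), one_smul]
  have hint : Integrable (Function.uncurry fun (θ : ℝ) (w : Cn n) => h (circleMap 0 1 θ • w))
      ((volume.restrict (Set.Ioc 0 (2 * Real.pi))).prod (gaussian n s)) := by
    have hc : Continuous (Function.uncurry fun (θ : ℝ) (w : Cn n) => h (circleMap 0 1 θ • w)) := by
      have := hd.continuous
      have := continuous_circleMap 0 1
      unfold Function.uncurry
      fun_prop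
    rw [integrable_prod_iff hc.aestronglyMeasurable]
    constructor
    · refine Filter.Eventually.of_forall fun θ => ?_
      simp only [Function.uncurry, hcm]
      exact (measurePreserving_circle_smul (Circle.exp θ)).integrable_comp_of_integrable hi
    · have : ∀ θ : ℝ, ∫ w, ‖h (circleMap 0 1 θ • w)‖ ∂(gaussian n s) =
          ∫ w, ‖h w‖ ∂(gaussian n s) := fun θ => by
        have hmp := measurePreserving_circle_smul (n := n) (s := s) (Circle.exp θ)
        rw [hcm]
        conv_rhs => rw [← hmp.map_eq]
        rw [integral_map hmp.measurable.aemeasurable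
          hd.continuous.norm.aestronglyMeasurable]
      simp only [Function.uncurry, this]
      exact integrable_const _
  have hswap := integral_integral_swap hint
  rw [← intervalIntegral.integral_of_le (by positivity)] at hswap
  simp only [← intervalIntegral.integral_of_le (show (0 : ℝ) ≤ 2 * Real.pi by positivity), hmean,
    hrot] at hswap
  simp only [intervalIntegral.integral_const, sub_zero, integral_const, probReal_univ,
    one_smul] at hswap
  exact smul_right_injective ℂ (show (2 * Real.pi) ≠ 0 by positivity) hswap

/-! ### The reproducing property -/

/-- Translating the variable by `x` turns kernel times density ratio into `exp(-w · \overline x /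
t)`, which is holomorphic in `w`. The mean value property at the origin then returns `g x`. -/
lemma bergmanProj_eq_self (hp : 1 < p) (ht : 0 < t) {g : Cn n → ℂ} (hd : Differentiable ℂ g)
    (hg : MemLp g (ENNReal.ofReal p) (gaussian n (2 * t / p))) : bergmanProj t g = g := by
  funext x
  have hi := integrable_gaussian_add ht x (integrable_bergman hp ht hg x)
  have e : ∀ w, Real.exp (-(2 * (herm w x).re + normSq x) / t) •
      (Complex.exp (herm x (w + x) / (t : ℂ)) * g (w + x)) =
      Complex.exp (-herm w x / (t : ℂ)) * g (w + x) := fun w => by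
    rw [Complex.real_smul, Complex.ofReal_exp, ← mul_assoc, ← Complex.exp_add]
    congr 2
    have h1 : ((2 * (herm w x).re : ℝ) : ℂ) = herm w x + herm x w := by
      rw [← conj_herm w x, Complex.add_conj]
    push_cast at h1 ⊢
    rw [h1, herm_add_right, herm_self]
    ring
  rw [bergmanProj, integral_gaussian_add ht _ x]
  simp only [e] at hi ⊢
  rw [integral_gaussian_of_differentiable ht _ hi]
  · simp [herm]
  · have := differentiable_herm x
    refine Differentiable.mul ?_ (hd.comp (by fun_prop))
    fun_prop

/-! ### Exponential growth and the norm of the Fock space -/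

/-- `∑ |w_i|`. -/
def absSum (w : Cn n) : ℝ := ∑ i, ‖w i‖

lemma absSum_nonneg (w : Cn n) : 0 ≤ absSum w := Finset.sum_nonneg fun _ _ => norm_nonneg _

lemma continuous_absSum : Continuous (absSum (n := n)) := by
  unfold absSum
  fun_prop

lemma norm_herm_le_mul_absSum (z w : Cn n) : ‖herm z w‖ ≤ ‖z‖ * absSum w := norm_herm_le z w

lemma norm_herm_le_absSum_mul (w z : Cn n) : ‖herm w z‖ ≤ ‖z‖ * absSum w := by
  rw [← conj_herm, RCLike.norm_conj]
  exact norm_herm_le z w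

lemma norm_exp_herm_le (ht : 0 < t) (z w : Cn n) :
    ‖Complex.exp (herm z w / (t : ℂ))‖ ≤ Real.exp (‖z‖ / t * absSum w) := by
  rw [Complex.norm_exp, Complex.div_ofReal_re, div_mul_eq_mul_div]
  gcongr
  exact (Complex.re_le_norm _).trans (norm_herm_le z w)

lemma norm_exp_herm_le' (ht : 0 < t) (w z : Cn n) :
    ‖Complex.exp (herm w z / (t : ℂ))‖ ≤ Real.exp (‖z‖ / t * absSum w) := by
  rw [Complex.norm_exp, Complex.div_ofReal_re, div_mul_eq_mul_div]
  gcongr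
  exact (Complex.re_le_norm _).trans (norm_herm_le_absSum_mul w z)

/-- Quantitative weighted Hölder bound. -/
lemma exists_integral_exp_mul_le (n : ℕ) (hp : 1 < p) (ht : 0 < t) (R : ℝ) :
    ∃ C : ℝ, 0 ≤ C ∧ ∀ h : Cn n → ℂ, MemLp h (ENNReal.ofReal p) (gaussian n (2 * t / p)) →
      ∫ w, Real.exp (R * absSum w) * ‖h w‖ ∂(gaussian n t) ≤
        C * (eLpNorm h (ENNReal.ofReal p) (gaussian n (2 * t / p))).toReal := by
  have hp0 : 0 < p := by linarith
  have hpq : p.HolderConjugate (p.conjExponent) := Real.HolderConjugate.conjExponent hp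
  set q := p.conjExponent with hq
  have hq0 : 0 < q := hpq.symm.pos
  -- The density `exp(-|w|²/t)` is split into two equal halves: one weights `h` and yields its
  -- `L^p(μ_{2t/p})` norm, the other keeps the exponential factor in `L^q`.
  set E : Cn n → ℝ≥0∞ := fun w =>
    ENNReal.ofReal (Real.exp (R * ∑ i, ‖w i‖ - 1 / (2 * t) * normSq w)) with hE
  have hEm : Measurable E := by
    have := continuous_normSq (n := n)
    fun_prop
  have hEfin : (∫⁻ w, E w ^ q) ^ (1 / q) < ∞ := by
    refine ENNReal.rpow_lt_top_of_nonneg (by positivity) ?_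
    have := lintegral_exp_lt_top (n := n) (c := 1 / (2 * t) * q) (by positivity) (R * q)
    convert! this.ne using 3 with w
    rw [hE]
    simp only
    rw [ENNReal.ofReal_rpow_of_pos (Real.exp_pos _), ← Real.exp_mul]
    congr 2
    ring
  -- The norm of `h` contains the `p`-th root of the normalizing constant; `C` has to divide it out.
  set g' := gconst n (2 * t / p) ^ (1 / p) with hg'
  have hg0 : g' ≠ 0 := by
    have := gconst_ne_zero (n := n) (s := 2 * t / p) (by positivity)
    simp [hg', this, gconst_ne_top]
  have hgt : g' ≠ ∞ := ENNReal.rpow_ne_top_of_nonneg (by positivity) (gconst_ne_top _)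
  set C : ℝ≥0∞ := gconst n t * ((∫⁻ w, E w ^ q) ^ (1 / q) * g'⁻¹) with hC
  have hCt : C ≠ ∞ := ENNReal.mul_ne_top (gconst_ne_top t)
    (ENNReal.mul_ne_top hEfin.ne (ENNReal.inv_ne_top.mpr hg0))
  refine ⟨C.toReal, ENNReal.toReal_nonneg, fun h hh => ?_⟩
  have hvol : AEStronglyMeasurable h volume :=
    hh.1.mono_ac (absolutelyContinuous_gaussian (by positivity))
  have hi : Integrable (fun w => Real.exp (R * absSum w) * ‖h w‖) (gaussian n t) :=
    integrable_exp_mul hp ht hh R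
  rw [← ENNReal.toReal_mul, integral_eq_lintegral_of_nonneg_ae
    (Filter.Eventually.of_forall fun w => by positivity) hi.1]
  refine ENNReal.toReal_mono (ENNReal.mul_ne_top hCt hh.2.ne) ?_
  rw [lintegral_gaussian ht, eLpNorm_gaussian hp ht, ENNReal.mul_rpow_of_nonneg _ _ (by positivity),
    hC, ← hg', mul_assoc, mul_assoc]
  refine mul_le_mul_right ?_ _
  rw [← mul_assoc g'⁻¹, ENNReal.inv_mul_cancel hg0 hgt, one_mul, mul_comm]
  calc ∫⁻ w, ENNReal.ofReal (Real.exp (R * absSum w) * ‖h w‖) *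
        ENNReal.ofReal (Real.exp (-normSq w / t))
      = ∫⁻ w, ((fun w => ‖h w‖ₑ * weight t w) * E) w := by
        refine lintegral_congr fun w => ?_
        simp only [Pi.mul_apply, hE, weight, absSum]
        rw [ENNReal.ofReal_mul (Real.exp_nonneg _), ofReal_norm, mul_right_comm,
          ← ENNReal.ofReal_mul (Real.exp_nonneg _), ← Real.exp_add,
          mul_comm _ (‖h w‖ₑ), mul_assoc,
          ← ENNReal.ofReal_mul (Real.exp_nonneg _), ← Real.exp_add]
        congr 3
        field_simp
        ring
    _ ≤ _ := ENNReal.lintegral_mul_le_Lp_mul_Lq volume hpq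
        ((hvol.enorm).mul (measurable_weight t).aemeasurable) hEm.aemeasurable

lemma memLp_exp_absSum (hp : 1 < p) (ht : 0 < t) (R : ℝ) :
    MemLp (fun w : Cn n => Real.exp (R * absSum w)) (ENNReal.ofReal p)
      (gaussian n (2 * t / p)) := by
  have hp0 : 0 < p := by linarith
  have hc : Continuous fun w : Cn n => Real.exp (R * absSum w) := by
    have := continuous_absSum (n := n)
    fun_prop
  have e : eLpNorm (fun w : Cn n => Real.exp (R * absSum w)) (ENNReal.ofReal p)
      (gaussian n (2 * t / p)) = eLpNorm (fun w : Cn n => ((Real.exp (R * absSum w) : ℝ) : ℂ))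
      (ENNReal.ofReal p) (gaussian n (2 * t / p)) :=
    eLpNorm_congr_norm_ae (Filter.Eventually.of_forall fun w => (Complex.norm_real _).symm)
  refine ⟨hc.aestronglyMeasurable, ?_⟩
  rw [e, eLpNorm_gaussian hp ht]
  refine ENNReal.rpow_lt_top_of_nonneg (by positivity)
    (ENNReal.mul_lt_top (gconst_ne_top _).lt_top ?_).ne
  have := lintegral_exp_lt_top (n := n) (c := 1 / (2 * t) * p) (by positivity) (R * p)
  convert! this using 3 with w
  rw [weight, ← ofReal_norm, Complex.norm_real, Real.norm_of_nonneg (Real.exp_nonneg _),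
    ← ENNReal.ofReal_mul (Real.exp_nonneg _), ← Real.exp_add,
    ENNReal.ofReal_rpow_of_pos (Real.exp_pos _), ← Real.exp_mul]
  congr 2
  simp only [absSum]
  ring

lemma FockSpace.ext {f g : FockSpace n p t} (h : ∀ w, f w = g w) : f = g :=
  Subtype.ext (funext h)

lemma FockSpace.add_apply (f g : FockSpace n p t) (w : Cn n) : (f + g) w = f w + g w := rfl

lemma FockSpace.sub_apply (f g : FockSpace n p t) (w : Cn n) : (f - g) w = f w - g w := rfl

lemma FockSpace.smul_apply (c : ℂ) (f : FockSpace n p t) (w : Cn n) : (c • f) w = c * f w := rfl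

section

variable [hp : Fact (1 < p)] [ht : Fact (0 < t)]

/-- An entire function of exponential growth, as an element of the Fock space. -/
def ofExpGrowth (f : Cn n → ℂ) (hd : Differentiable ℂ f) (c R : ℝ)
    (hf : ∀ w, ‖f w‖ ≤ c * Real.exp (R * absSum w)) : FockSpace n p t :=
  ⟨f, hd, ((memLp_exp_absSum hp.out ht.out R).const_mul c).mono' hd.continuous.aestronglyMeasurable
    (Filter.Eventually.of_forall hf)⟩

@[simp]
lemma ofExpGrowth_apply (f : Cn n → ℂ) (hd : Differentiable ℂ f) (c R : ℝ)
    (hf : ∀ w, ‖f w‖ ≤ c * Real.exp (R * absSum w)) (w : Cn n) :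
    (ofExpGrowth f hd c R hf : FockSpace n p t) w = f w := rfl

variable (n p t) in
-- Here `D` depends on `R` alone, so a pointwise estimate with small prefactor `c` becomes a small
-- norm. Continuity and differentiability of kernels in the Fock norm are derived in this way.
lemma exists_norm_le_of_expGrowth (R : ℝ) : ∃ D : ℝ, 0 ≤ D ∧ ∀ (f : FockSpace n p t) (c : ℝ),
    0 ≤ c → (∀ w, ‖f w‖ ≤ c * Real.exp (R * absSum w)) → ‖f‖ ≤ c * D := by
  refine ⟨(eLpNorm (fun w : Cn n => Real.exp (R * absSum w)) (ENNReal.ofReal p)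
    (gaussian n (2 * t / p))).toReal, ENNReal.toReal_nonneg, fun f c hc hf => ?_⟩
  have hm := memLp_exp_absSum (n := n) hp.out ht.out R
  rw [FockSpace.norm_def, ← ENNReal.toReal_ofReal hc, ← ENNReal.toReal_mul]
  refine ENNReal.toReal_mono (ENNReal.mul_ne_top ENNReal.ofReal_ne_top hm.2.ne) ?_
  refine eLpNorm_le_mul_eLpNorm_of_ae_le_mul (Filter.Eventually.of_forall fun w => ?_) _
  rw [Real.norm_of_nonneg (Real.exp_nonneg _)]
  exact hf w

lemma FockSpace.bergmanProj_eq (f : FockSpace n p t) : bergmanProj t f = f :=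
  bergmanProj_eq_self hp.out ht.out f.differentiable f.memLp

/-- Point evaluation on the Fock space. -/
def evalCLM (x : Cn n) : FockSpace n p t →L[ℂ] ℂ :=
  LinearMap.mkContinuous
    { toFun := fun f => f x
      map_add' := fun _ _ => rfl
      map_smul' := fun _ _ => rfl }
    (exists_integral_exp_mul_le n hp.out ht.out (‖x‖ / t)).choose (fun f => by
      have hC := (exists_integral_exp_mul_le n hp.out ht.out (‖x‖ / t)).choose_spec.2 f f.memLp
      rw [← FockSpace.norm_def] at hC
      refine le_trans ?_ hC
      change ‖f x‖ ≤ _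
      -- By the reproducing property the value at `x` is an integral of `f`, to which the weighted
      -- Hölder bound applies.
      conv_lhs => rw [← FockSpace.bergmanProj_eq f]
      refine (norm_integral_le_integral_norm _).trans (integral_mono
        (integrable_bergman hp.out ht.out f.memLp x).norm
        (integrable_exp_mul hp.out ht.out f.memLp _) fun w => ?_)
      simp only [norm_mul]
      gcongr
      exact norm_exp_herm_le ht.out x w)

@[simp]
lemma evalCLM_apply (x : Cn n) (f : FockSpace n p t) : evalCLM x f = f x := rfl

/-- The projection of an `L^p`-function onto the Fock space. -/
def projFock (h : Cn n → ℂ) (hh : MemLp h (ENNReal.ofReal p) (gaussian n (2 * t / p))) :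
    FockSpace n p t :=
  ⟨bergmanProj t h, differentiable_bergmanProj hp.out ht.out hh,
    (differentiable_bergmanProj hp.out ht.out hh).continuous.aestronglyMeasurable,
    (eLpNorm_bergmanProj_le hp.out ht.out hh).trans_lt
      (ENNReal.mul_lt_top (projBound_lt_top ht.out) hh.2)⟩

lemma projFock_self (f : FockSpace n p t) : projFock f f.memLp = f :=
  Subtype.ext f.bergmanProj_eq

lemma norm_projFock_sub_le {g h : Cn n → ℂ}
    (hg : MemLp g (ENNReal.ofReal p) (gaussian n (2 * t / p)))
    (hh : MemLp h (ENNReal.ofReal p) (gaussian n (2 * t / p))) :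
    ‖(projFock g hg - projFock h hh : FockSpace n p t)‖ ≤ (projBound n t).toReal *
      (eLpNorm (g - h) (ENNReal.ofReal p) (gaussian n (2 * t / p))).toReal := by
  have e : (projFock g hg - projFock h hh : FockSpace n p t) = projFock (g - h) (hg.sub hh) := by
    refine FockSpace.ext fun x => ?_
    change bergmanProj t g x - bergmanProj t h x = bergmanProj t (g - h) x
    unfold bergmanProj
    rw [← integral_sub (integrable_bergman hp.out ht.out hg x)
      (integrable_bergman hp.out ht.out hh x)]
    simp only [Pi.sub_apply, mul_sub]
  rw [e, FockSpace.norm_def, ← ENNReal.toReal_mul]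
  exact ENNReal.toReal_mono (ENNReal.mul_ne_top (projBound_lt_top ht.out).ne (hg.sub hh).2.ne)
    (eLpNorm_bergmanProj_le hp.out ht.out (hg.sub hh))

/-- The projection `P_t` is bounded, fixes every Fock function and has entire values. Hence the
projection of an `L^p` limit is the limit in the Fock space, and no closedness of holomorphic
functions in `L^p` is needed. Completeness gives meaning to the vector-valued integrals below. -/
instance : CompleteSpace (FockSpace n p t) := by
  refine Metric.complete_of_cauchySeq_tendsto fun u hu => ?_
  have hu' : CauchySeq fun k => FockSpace.toLp (u k) := by
    rw [Metric.cauchySeq_iff] at hu ⊢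
    intro ε hε
    obtain ⟨N, hN⟩ := hu ε hε
    refine ⟨N, fun k hk l hl => ?_⟩
    have := hN k hk l hl
    rw [dist_eq_norm] at this ⊢
    rwa [← map_sub]
  obtain ⟨h, hh⟩ := cauchySeq_tendsto_of_complete hu'
  refine ⟨projFock h (Lp.memLp h), ?_⟩
  rw [tendsto_iff_norm_sub_tendsto_zero] at hh ⊢
  refine squeeze_zero (fun _ => norm_nonneg _) (fun k => ?_)
    (by simpa using hh.const_mul (projBound n t).toReal)
  conv_lhs => rw [← projFock_self (u k)]
  refine (norm_projFock_sub_le _ _).trans (le_of_eq ?_)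
  rw [Lp.norm_def]
  congr 2
  refine eLpNorm_congr_ae ?_
  filter_upwards [Lp.coeFn_sub (FockSpace.toLp (u k)) h, (u k).memLp.coeFn_toLp] with w h1 h2
  rw [h1, Pi.sub_apply, Pi.sub_apply, ← h2]
  rfl

/-- The kernel `K_a(w) = exp(w · \overline a / t)`. -/
def expKernel (a : Cn n) : FockSpace n p t :=
  ofExpGrowth (fun w => Complex.exp (herm w a / (t : ℂ)))
    (by have := differentiable_herm a; fun_prop) 1 (‖a‖ / t)
    (fun w => by rw [one_mul]; exact norm_exp_herm_le' ht.out w a)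

@[simp]
lemma expKernel_apply (a w : Cn n) :
    (expKernel a : FockSpace n p t) w = Complex.exp (herm w a / (t : ℂ)) := rfl

lemma fockKernel_eq_smul (a : Cn n) : (fockKernel a : FockSpace n p t) =
    Complex.exp (-((normSq a : ℂ) / (2 * (t : ℂ)))) • expKernel a := by
  refine FockSpace.ext fun w => ?_
  rw [FockSpace.smul_apply, fockKernel_apply, kernelFun, expKernel_apply, ← Complex.exp_add]
  congr 1
  ring

lemma berezin_eq (A : FockSpace n p t →L[ℂ] FockSpace n p t) (z : Cn n) :
    berezin A z = Complex.exp (-((normSq z : ℂ) / (2 * (t : ℂ)))) * A (fockKernel z) z := by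
  conv_rhs => rw [← FockSpace.bergmanProj_eq (A (fockKernel z))]
  rw [bergmanProj, ← integral_const_mul, berezin]
  refine integral_congr_ae (Filter.Eventually.of_forall fun w => ?_)
  simp only
  rw [mul_comm, ← mul_assoc, ← Complex.exp_add, kernelFun, ← Complex.exp_conj]
  congr 2
  simp only [map_sub, map_div₀, conj_herm, Complex.conj_ofReal, map_mul, map_ofNat]
  ring

/-- With the unnormalized kernel, the Berezin transform is a nonvanishing factor times the diagonal
of a function antiholomorphic in one variable and holomorphic in the other. -/
lemma berezin_eq_expKernel (A : FockSpace n p t →L[ℂ] FockSpace n p t) (z : Cn n) :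
    berezin A z = Complex.exp (-((normSq z : ℂ) / (t : ℂ))) * A (expKernel z) z := by
  rw [berezin_eq, fockKernel_eq_smul, map_smul, FockSpace.smul_apply, ← mul_assoc,
    ← Complex.exp_add]
  congr 2
  have : (t : ℂ) ≠ 0 := by exact_mod_cast ht.out.ne'
  field_simp
  ring

end

/-! ### The action of `ℂⁿ` on operators -/

section

variable [hp : Fact (1 < p)] [ht : Fact (0 < t)]

omit hp in
lemma two_mul_re_herm (z w : Cn n) :
    ((2 * (herm z w).re : ℝ) : ℂ) = herm z w + herm w z := by
  rw [← conj_herm z w, Complex.add_conj]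

/-- The Weyl operators represent translations only up to a phase; the phase cancels under
conjugation, which makes `α` a genuine group action. -/
lemma weyl_weyl (z w : Cn n) (f : FockSpace n p t) :
    weyl z (weyl w f) =
      Complex.exp ((herm w z - herm z w) / (2 * (t : ℂ))) • weyl (z + w) f := by
  have ht0 : (t : ℂ) ≠ 0 := by exact_mod_cast ht.out.ne'
  refine FockSpace.ext fun x => ?_
  rw [FockSpace.smul_apply, weyl_apply, weyl_apply, weyl_apply, sub_sub, ← mul_assoc, ← mul_assoc]
  congr 1
  simp only [kernelFun, ← Complex.exp_add]
  congr 1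
  have h := two_mul_re_herm z w
  have hn : (normSq (z + w) : ℂ) = normSq z + (herm z w + herm w z) + normSq w := by
    rw [normSq_add, ← h]
    push_cast
    ring
  rw [hn, herm_sub_left, herm_add_right]
  field_simp
  ring

lemma weyl_zero (f : FockSpace n p t) : weyl 0 f = f :=
  FockSpace.ext fun x => by simp [kernelFun, herm, normSq]

lemma weyl_neg_weyl (z : Cn n) (f : FockSpace n p t) : weyl (-z) (weyl z f) = f := by
  rw [weyl_weyl, herm_neg_left, herm_neg_right, neg_add_cancel, weyl_zero, sub_self, zero_div,
    Complex.exp_zero, one_smul]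

lemma weyl_fockKernel_zero (z : Cn n) :
    weyl z (fockKernel 0 : FockSpace n p t) = fockKernel z :=
  FockSpace.ext fun x => by simp [kernelFun, herm, normSq]

lemma norm_weyl_le (z : Cn n) : ‖(weyl z : FockSpace n p t →L[ℂ] FockSpace n p t)‖ ≤ 1 :=
  LinearMap.mkContinuous_norm_le _ zero_le_one _

lemma shiftOp_apply (z : Cn n) (A : FockSpace n p t →L[ℂ] FockSpace n p t)
    (f : FockSpace n p t) : shiftOp z A f = weyl z (A (weyl (-z) f)) := rfl

lemma shiftOp_shiftOp (z w : Cn n) (A : FockSpace n p t →L[ℂ] FockSpace n p t) :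
    shiftOp z (shiftOp w A) = shiftOp (z + w) A := by
  ext1 f
  simp only [shiftOp_apply]
  rw [weyl_weyl, weyl_weyl, map_smul, map_smul, smul_smul, ← Complex.exp_add]
  have : (herm w z - herm z w) / (2 * (t : ℂ)) +
      (herm (-z) (-w) - herm (-w) (-z)) / (2 * (t : ℂ)) = 0 := by
    simp only [herm_neg_left, herm_neg_right, neg_neg]
    ring
  rw [this, Complex.exp_zero, one_smul, neg_add, add_comm (-w)]

lemma shiftOp_zero (A : FockSpace n p t →L[ℂ] FockSpace n p t) : shiftOp 0 A = A := by
  ext1 f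
  rw [shiftOp_apply, neg_zero, weyl_zero, weyl_zero]

lemma shiftOp_mul (z : Cn n) (A B : FockSpace n p t →L[ℂ] FockSpace n p t) :
    shiftOp z (A * B) = shiftOp z A * shiftOp z B := by
  ext1 f
  simp only [shiftOp_apply, mul_apply_eq_comp, weyl_neg_weyl]

lemma norm_shiftOp_le (z : Cn n) (A : FockSpace n p t →L[ℂ] FockSpace n p t) :
    ‖shiftOp z A‖ ≤ ‖A‖ := by
  refine (ContinuousLinearMap.opNorm_comp_le _ _).trans ?_
  refine (mul_le_of_le_one_left (norm_nonneg _) (norm_weyl_le z)).trans ?_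
  refine (ContinuousLinearMap.opNorm_comp_le _ _).trans ?_
  exact mul_le_of_le_one_right (norm_nonneg _) (norm_weyl_le (-z))

variable (p t) in
/-- The action `α_z` as a continuous linear map. -/
def shiftOpL (z : Cn n) :
    (FockSpace n p t →L[ℂ] FockSpace n p t) →L[ℂ] (FockSpace n p t →L[ℂ] FockSpace n p t) :=
  LinearMap.mkContinuous
    { toFun := shiftOp z
      map_add' := fun A B => by ext1 f; simp [shiftOp_apply]
      map_smul' := fun c A => by ext1 f; simp [shiftOp_apply] }
    1 (fun A => by rw [one_mul]; exact norm_shiftOp_le z A)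

@[simp]
lemma shiftOpL_apply (z : Cn n) (A : FockSpace n p t →L[ℂ] FockSpace n p t) :
    shiftOpL p t z A = shiftOp z A := rfl

/-! ### The Berezin transform as one functional evaluated along an orbit -/

variable (n p t) in
/-- The value of the Berezin transform at the origin, as a functional. -/
def berezinZero : (FockSpace n p t →L[ℂ] FockSpace n p t) →L[ℂ] ℂ :=
  evalCLM 0 ∘L ContinuousLinearMap.apply ℂ (FockSpace n p t) (fockKernel 0)

/-- Since `k_z = W_z k_0`, evaluating at `z` amounts to moving the operator by `-z` and evaluating
at the origin. Boundedness, covariance and uniform continuity of the Berezin transform all follow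
from this form. -/
lemma berezin_eq_berezinZero (A : FockSpace n p t →L[ℂ] FockSpace n p t) (z : Cn n) :
    berezin A z = berezinZero n p t (shiftOp (-z) A) := by
  change _ = (shiftOp (-z) A) (fockKernel 0) 0
  rw [berezin_eq, shiftOp_apply, neg_neg, weyl_fockKernel_zero, weyl_apply, sub_neg_eq_add,
    zero_add, kernelFun, normSq_neg]
  congr 2
  simp [herm]

lemma berezin_shiftOp (A : FockSpace n p t →L[ℂ] FockSpace n p t) (w z : Cn n) :
    berezin (shiftOp w A) z = berezin A (z - w) := by
  rw [berezin_eq_berezinZero, berezin_eq_berezinZero, shiftOp_shiftOp]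
  congr 2
  abel

lemma norm_berezin_le (A : FockSpace n p t →L[ℂ] FockSpace n p t) (z : Cn n) :
    ‖berezin A z‖ ≤ ‖berezinZero n p t‖ * ‖A‖ := by
  rw [berezin_eq_berezinZero]
  refine (ContinuousLinearMap.le_opNorm _ _).trans ?_
  gcongr
  exact norm_shiftOp_le _ _

omit hp ht in
lemma memLp_top_sub {f : Cn n → ℂ} (hf : MemLp f ∞ volume) (z : Cn n) :
    MemLp (fun w => f (w - z)) ∞ volume :=
  hf.comp_measurePreserving (measurePreserving_sub_right volume z)

/-- Translating the integration variable by `z` on the right reduces covariance to the identity `e`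
between exponents. -/
lemma shiftOp_toeplitz (z : Cn n) (f : Cn n → ℂ) (hf : MemLp f ∞ volume) :
    (shiftOp z (toeplitz f hf) : FockSpace n p t →L[ℂ] FockSpace n p t) =
      toeplitz (fun w => f (w - z)) (memLp_top_sub hf z) := by
  have ht0 : (t : ℂ) ≠ 0 := by exact_mod_cast ht.out.ne'
  ext1 g
  refine FockSpace.ext fun x => ?_
  rw [shiftOp_apply, weyl_apply, toeplitz_apply, toeplitz_apply, bergmanProj, bergmanProj,
    ← integral_const_mul]
  conv_rhs => rw [integral_gaussian_add ht.out _ z]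
  refine integral_congr_ae (Filter.Eventually.of_forall fun w => ?_)
  simp only [weyl_apply, add_sub_cancel_right, sub_neg_eq_add, Complex.real_smul,
    Complex.ofReal_exp]
  have e : Complex.exp (((-(2 * (herm w z).re + normSq z) / t : ℝ) : ℂ)) *
      Complex.exp (herm x (w + z) / (t : ℂ)) =
      kernelFun t z x * Complex.exp (herm (x - z) w / (t : ℂ)) * kernelFun t (-z) w := by
    simp only [kernelFun, ← Complex.exp_add]
    congr 1
    have h := two_mul_re_herm w z
    push_cast at h ⊢
    rw [h, herm_sub_left, herm_add_right, herm_neg_right, normSq_neg]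
    field_simp
    ring
  linear_combination (-f w * g (w + z)) * e

end

/-! ### Norm continuity of the action on Toeplitz operators -/

/-- The convolution kernel dominating differences of translated Toeplitz operators. -/
def shiftMajorant (n : ℕ) (t : ℝ) (u : Cn n) : ℝ≥0∞ :=
  ENNReal.ofReal (Real.exp (2 / t * absSum u - 1 / (2 * t) * normSq u))

lemma measurable_shiftMajorant : Measurable (shiftMajorant n t) := by
  have := continuous_normSq (n := n)
  have := continuous_absSum (n := n)
  unfold shiftMajorant
  fun_prop

lemma lintegral_shiftMajorant_lt_top (ht : 0 < t) : ∫⁻ u, shiftMajorant n t u < ∞ :=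
  lintegral_exp_lt_top (by positivity) _

/-- Young's inequality is applied twice, once for each convolution with `κ`, after the weight has
turned the Gaussian norm into a Lebesgue one. -/
lemma eLpNorm_le_of_le_convolution (hp : 1 < p) (ht : 0 < t) {D g : Cn n → ℂ}
    {κ : Cn n → ℝ≥0∞} (hκ : Measurable κ) {c : ℝ≥0∞} (hc : c ≠ ∞) (hg : Measurable g)
    (h : ∀ x, ‖D x‖ₑ * weight t x ≤
      c * ∫⁻ w, κ (x - w) * ∫⁻ y, κ (w - y) * (‖g y‖ₑ * weight t y)) :
    eLpNorm D (ENNReal.ofReal p) (gaussian n (2 * t / p)) ≤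
      c * (∫⁻ u, κ u) ^ 2 * eLpNorm g (ENNReal.ofReal p) (gaussian n (2 * t / p)) := by
  have hp0 : 0 < p := by linarith
  have hH : Measurable fun y => ‖g y‖ₑ * weight t y := hg.enorm.mul (measurable_weight t)
  have hH2 : Measurable fun w => ∫⁻ y, κ (w - y) * (‖g y‖ₑ * weight t y) := by
    refine Measurable.lintegral_prod_right' (f := fun q : Cn n × Cn n =>
      κ (q.1 - q.2) * (‖g q.2‖ₑ * weight t q.2)) ?_
    exact (hκ.comp (measurable_fst.sub measurable_snd)).mul (hH.comp measurable_snd)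
  rw [eLpNorm_gaussian hp ht, eLpNorm_gaussian hp ht]
  have e : c * (∫⁻ u, κ u) ^ 2 = ((c * (∫⁻ u, κ u) ^ 2) ^ p) ^ (1 / p) := by
    rw [← ENNReal.rpow_mul, mul_one_div_cancel hp0.ne', ENNReal.rpow_one]
  rw [e, ← ENNReal.mul_rpow_of_nonneg _ _ (by positivity)]
  refine ENNReal.rpow_le_rpow ?_ (by positivity)
  rw [mul_left_comm]
  refine mul_le_mul_right ?_ _
  calc ∫⁻ x, (‖D x‖ₑ * weight t x) ^ p
      ≤ ∫⁻ x, (c * ∫⁻ w, κ (x - w) * ∫⁻ y, κ (w - y) * (‖g y‖ₑ * weight t y)) ^ p := by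
        refine lintegral_mono fun x => ?_
        have := h x
        gcongr
    _ = c ^ p * ∫⁻ x, (∫⁻ w, κ (x - w) * ∫⁻ y, κ (w - y) * (‖g y‖ₑ * weight t y)) ^ p := by
        simp_rw [ENNReal.mul_rpow_of_nonneg _ _ hp0.le]
        exact lintegral_const_mul' _ _ (ENNReal.rpow_ne_top_of_nonneg hp0.le hc)
    _ ≤ c ^ p * ((∫⁻ u, κ u) ^ p * ∫⁻ w, (∫⁻ y, κ (w - y) * (‖g y‖ₑ * weight t y)) ^ p) := by
        gcongr
        exact lintegral_young hp hκ hH2.aemeasurable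
    _ ≤ c ^ p * ((∫⁻ u, κ u) ^ p * ((∫⁻ u, κ u) ^ p * ∫⁻ y, (‖g y‖ₑ * weight t y) ^ p)) := by
        gcongr
        exact lintegral_young hp hκ hH.aemeasurable
    _ = _ := by
        rw [pow_two, ENNReal.mul_rpow_of_nonneg _ _ hp0.le, ENNReal.mul_rpow_of_nonneg _ _ hp0.le]
        ring

lemma ofReal_exp_add (a b : ℝ) : ENNReal.ofReal (Real.exp (a + b)) =
    ENNReal.ofReal (Real.exp a) * ENNReal.ofReal (Real.exp b) := by
  rw [Real.exp_add, ENNReal.ofReal_mul (Real.exp_nonneg _)]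

lemma norm_cexp_sub_one_le (z : ℂ) : ‖Complex.exp z - 1‖ ≤ ‖z‖ * Real.exp ‖z‖ := by
  have := Complex.norm_exp_sub_sum_le_norm_mul_exp z 1
  simpa using this

lemma absSum_le (z : Cn n) : absSum z ≤ n * ‖z‖ := by
  unfold absSum
  refine (Finset.sum_le_sum fun i _ => norm_le_pi_norm z i).trans ?_
  simp

/-- The logarithm of the ratio of a translated kernel and the original one is small. -/
lemma norm_exp_shift_sub_one_le (ht : 0 < t) {z : Cn n} (hz : ‖z‖ ≤ 1) (u v : Cn n) :
    ‖Complex.exp ((herm u z - herm z v - normSq z) / (t : ℂ)) - 1‖ ≤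
      ‖z‖ * Real.exp (2 * n / t) * (Real.exp (2 / t * absSum u) * Real.exp (2 / t * absSum v)) := by
  -- The exponent is at most `‖z‖ * m`. The linear factor `m` is absorbed by a second `exp m`; the
  -- resulting `exp (2m)` explains the constants `2 / t` and `2 * n / t`.
  set m := (absSum u + absSum v + n) / t with hm
  have hm0 : 0 ≤ m := by
    have := absSum_nonneg u
    have := absSum_nonneg v
    positivity
  have h1 : ‖(herm u z - herm z v - normSq z) / (t : ℂ)‖ ≤ ‖z‖ * m := by
    rw [norm_div, Complex.norm_real, Real.norm_of_nonneg ht.le, hm, ← mul_div_assoc]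
    gcongr
    refine (norm_sub_le _ _).trans ?_
    rw [← herm_self]
    have h3 := norm_herm_le_mul_absSum z z
    have h4 := norm_herm_le_mul_absSum z v
    have h5 := norm_herm_le_absSum_mul u z
    have h6 := norm_sub_le (herm u z) (herm z v)
    have h7 : absSum z ≤ n := (absSum_le z).trans (mul_le_of_le_one_right (by positivity) hz)
    have h8 : ‖z‖ * absSum z ≤ ‖z‖ * n := by gcongr
    linarith
  have h2 : ‖z‖ * m ≤ m := mul_le_of_le_one_left hm0 hz
  calc _ ≤ ‖(herm u z - herm z v - normSq z) / (t : ℂ)‖ *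
        Real.exp ‖(herm u z - herm z v - normSq z) / (t : ℂ)‖ := norm_cexp_sub_one_le _
    _ ≤ (‖z‖ * m) * Real.exp m := by
        gcongr
        exact h1.trans h2
    _ ≤ (‖z‖ * Real.exp m) * Real.exp m := by
        gcongr
        linarith [Real.add_one_le_exp m]
    _ = _ := by
        rw [mul_assoc, mul_assoc, ← Real.exp_add, ← Real.exp_add, ← Real.exp_add]
        congr 2
        rw [hm]
        ring

/-- Writing `g = P_t g` at both `w + z` and `w` moves the translation from `g` into the kernels.
Both terms become integrals of the same `g y`, and their difference is a factor `exp(…) - 1` of size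
`O(‖z‖)`. -/
lemma enorm_translate_sub_le (hp : 1 < p) (ht : 0 < t) {g : Cn n → ℂ}
    (hg : MemLp g (ENNReal.ofReal p) (gaussian n (2 * t / p))) (hgP : bergmanProj t g = g)
    {z : Cn n} (hz : ‖z‖ ≤ 1) (x w : Cn n) :
    ‖Complex.exp ((-(2 * (herm w z).re + normSq z) / t : ℝ)) *
        (Complex.exp (herm x (w + z) / (t : ℂ)) * g (w + z)) -
        Complex.exp (herm x w / (t : ℂ)) * g w‖ₑ *
      (ENNReal.ofReal (Real.exp (-normSq w / t)) * weight t x) ≤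
    gconst n t * ENNReal.ofReal (‖z‖ * Real.exp (2 * n / t)) * (shiftMajorant n t (x - w) *
      ∫⁻ y, shiftMajorant n t (w - y) * (‖g y‖ₑ * weight t y)) := by
  have hi1 := integrable_bergman hp ht hg (w + z)
  have hi0 := integrable_bergman hp ht hg w
  have e : Complex.exp ((-(2 * (herm w z).re + normSq z) / t : ℝ)) *
        (Complex.exp (herm x (w + z) / (t : ℂ)) * g (w + z)) -
        Complex.exp (herm x w / (t : ℂ)) * g w =
      ∫ y, Complex.exp (herm x w / (t : ℂ)) * (Complex.exp (herm w y / (t : ℂ)) *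
        (Complex.exp ((herm (x - w) z - herm z (w - y) - normSq z) / (t : ℂ)) - 1)) * g y
        ∂(gaussian n t) := by
    conv_lhs => rw [← hgP]
    unfold bergmanProj
    rw [← mul_assoc, ← integral_const_mul, ← integral_const_mul, ← integral_sub
      (hi1.const_mul _) (hi0.const_mul _)]
    refine integral_congr_ae (Filter.Eventually.of_forall fun y => ?_)
    have h := two_mul_re_herm w z
    have e1 : Complex.exp ((-(2 * (herm w z).re + normSq z) / t : ℝ)) *
        Complex.exp (herm x (w + z) / (t : ℂ)) * Complex.exp (herm (w + z) y / (t : ℂ)) =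
        Complex.exp (herm x w / (t : ℂ)) * Complex.exp (herm w y / (t : ℂ)) *
        Complex.exp ((herm (x - w) z - herm z (w - y) - normSq z) / (t : ℂ)) := by
      simp only [← Complex.exp_add]
      congr 1
      push_cast at h ⊢
      rw [h, herm_sub_left, herm_sub_right, herm_add_right, herm_add_left]
      ring
    simp only
    linear_combination g y * e1
  -- Completing squares: `exp(-|w|²/t)` gives one half to each of the Gaussians in `x - w` and `w -
  -- y`, while one half of `exp(-|y|²/t)` stays behind as the weight of `g`.
  have hb : ∀ y, ‖Complex.exp (herm x w / (t : ℂ)) * (Complex.exp (herm w y / (t : ℂ)) *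
        (Complex.exp ((herm (x - w) z - herm z (w - y) - normSq z) / (t : ℂ)) - 1)) * g y‖ₑ *
        ENNReal.ofReal (Real.exp (-normSq y / t)) *
        (ENNReal.ofReal (Real.exp (-normSq w / t)) * weight t x) ≤
      ENNReal.ofReal (‖z‖ * Real.exp (2 * n / t)) * (shiftMajorant n t (x - w) *
        (shiftMajorant n t (w - y) * (‖g y‖ₑ * weight t y))) := fun y => by
    have h1 := norm_exp_shift_sub_one_le ht hz (x - w) (w - y)
    have h1' := ENNReal.ofReal_le_ofReal h1
    rw [ofReal_norm, ENNReal.ofReal_mul (by positivity)] at h1'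
    rw [enorm_mul, enorm_mul, enorm_mul]
    calc _ ≤ ‖Complex.exp (herm x w / (t : ℂ))‖ₑ * (‖Complex.exp (herm w y / (t : ℂ))‖ₑ *
          (ENNReal.ofReal (‖z‖ * Real.exp (2 * n / t)) * ENNReal.ofReal
            (Real.exp (2 / t * absSum (x - w)) * Real.exp (2 / t * absSum (w - y))))) * ‖g y‖ₑ *
          ENNReal.ofReal (Real.exp (-normSq y / t)) *
          (ENNReal.ofReal (Real.exp (-normSq w / t)) * weight t x) := by gcongr
      _ = _ := by
        have e2 : ∀ a b c d e f g' h' : ℝ, a + b + (c + d) + e + f + g' = h' →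
            ∀ X Y : ℝ≥0∞, ENNReal.ofReal (Real.exp a) * (ENNReal.ofReal (Real.exp b) *
            (X * ENNReal.ofReal (Real.exp c * Real.exp d))) * Y * ENNReal.ofReal (Real.exp e) *
            (ENNReal.ofReal (Real.exp f) * ENNReal.ofReal (Real.exp g')) =
            X * (Y * ENNReal.ofReal (Real.exp h')) := by
          intro a b c d e f g' h' hsum X Y
          rw [← hsum, ← Real.exp_add]
          simp only [ofReal_exp_add]
          ring
        have e3 : ∀ a b c h' : ℝ, a + b + c = h' → ∀ Y : ℝ≥0∞,
            ENNReal.ofReal (Real.exp a) * (ENNReal.ofReal (Real.exp b) *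
            (Y * ENNReal.ofReal (Real.exp c))) = Y * ENNReal.ofReal (Real.exp h') := by
          intro a b c h' hsum Y
          rw [← hsum]
          simp only [ofReal_exp_add]
          ring
        rw [← ofReal_norm (Complex.exp (herm x w / (t : ℂ))),
          ← ofReal_norm (Complex.exp (herm w y / (t : ℂ))), Complex.norm_exp, Complex.norm_exp,
          Complex.div_ofReal_re, Complex.div_ofReal_re, weight, e2 _ _ _ _ _ _ _ _ rfl,
          shiftMajorant, shiftMajorant, weight, e3 _ _ _ _ rfl]
        congr 4
        rw [normSq_sub, normSq_sub]
        field_simp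
        ring
  have hne : ENNReal.ofReal (Real.exp (-normSq w / t)) * weight t x ≠ ∞ :=
    ENNReal.mul_ne_top ENNReal.ofReal_ne_top ENNReal.ofReal_ne_top
  rw [e]
  calc _ ≤ (∫⁻ y, ‖Complex.exp (herm x w / (t : ℂ)) * (Complex.exp (herm w y / (t : ℂ)) *
        (Complex.exp ((herm (x - w) z - herm z (w - y) - normSq z) / (t : ℂ)) - 1)) * g y‖ₑ
        ∂(gaussian n t)) * (ENNReal.ofReal (Real.exp (-normSq w / t)) * weight t x) := by
        gcongr
        exact enorm_integral_le_lintegral_enorm _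
    _ = gconst n t * ∫⁻ y, ‖Complex.exp (herm x w / (t : ℂ)) * (Complex.exp (herm w y / (t : ℂ)) *
        (Complex.exp ((herm (x - w) z - herm z (w - y) - normSq z) / (t : ℂ)) - 1)) * g y‖ₑ *
        ENNReal.ofReal (Real.exp (-normSq y / t)) *
        (ENNReal.ofReal (Real.exp (-normSq w / t)) * weight t x) := by
        rw [lintegral_gaussian ht, lintegral_mul_const' _ _ hne, mul_assoc]
    _ ≤ gconst n t * ∫⁻ y, ENNReal.ofReal (‖z‖ * Real.exp (2 * n / t)) *
        (shiftMajorant n t (x - w) *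
        (shiftMajorant n t (w - y) * (‖g y‖ₑ * weight t y))) := by
        exact mul_le_mul_right (lintegral_mono fun y => hb y) _
    _ = _ := by
        rw [lintegral_const_mul' _ _ ENNReal.ofReal_ne_top,
          lintegral_const_mul' _ _ (by exact ENNReal.ofReal_ne_top), mul_assoc]

section

variable [hp : Fact (1 < p)] [ht : Fact (0 < t)]

/-- The symbol is only `L^∞`, so its translates need not be close. A change of variables leaves `f`
in place and translates the kernel and `g` instead; `f` then enters only through its essential
supremum. -/
lemma exists_norm_shiftOp_toeplitz_sub_le (f : Cn n → ℂ) (hf : MemLp f ∞ volume) :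
    ∃ C : ℝ, ∀ z : Cn n, ‖z‖ ≤ 1 → ‖(shiftOp z (toeplitz f hf) - toeplitz f hf :
      FockSpace n p t →L[ℂ] FockSpace n p t)‖ ≤ C * ‖z‖ := by
  have hp1 := hp.out
  have ht1 := ht.out
  -- This is the constant `c` below with its factor `‖z‖` removed, times the two masses coming from
  -- Young's inequality.
  set C' : ℝ≥0∞ := gconst n t * (eLpNorm f ∞ volume * (gconst n t *
    ENNReal.ofReal (Real.exp (2 * n / t)))) * (∫⁻ u, shiftMajorant n t u) ^ 2 with hC'
  have hC't : C' ≠ ∞ := by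
    have h1 := gconst_ne_top (n := n) t
    have h2 := (lintegral_shiftMajorant_lt_top (n := n) ht1).ne
    have h3 := hf.2.ne
    rw [hC']
    refine ENNReal.mul_ne_top (ENNReal.mul_ne_top h1 (ENNReal.mul_ne_top h3
      (ENNReal.mul_ne_top h1 ENNReal.ofReal_ne_top))) (ENNReal.pow_ne_top h2)
  refine ⟨C'.toReal, fun z hz => ContinuousLinearMap.opNorm_le_bound _ (by positivity) fun g => ?_⟩
  set c : ℝ≥0∞ := gconst n t * (eLpNorm f ∞ volume *
    (gconst n t * ENNReal.ofReal (‖z‖ * Real.exp (2 * n / t)))) with hc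
  have hct : c ≠ ∞ := ENNReal.mul_ne_top (gconst_ne_top t) (ENNReal.mul_ne_top hf.2.ne
      (ENNReal.mul_ne_top (gconst_ne_top t) ENNReal.ofReal_ne_top))
  have hcC : c * (∫⁻ u, shiftMajorant n t u) ^ 2 = C' * ENNReal.ofReal ‖z‖ := by
    rw [hc, hC', ENNReal.ofReal_mul (norm_nonneg _)]
    ring
  have key := eLpNorm_le_of_le_convolution (D := fun x => (shiftOp z (toeplitz f hf) g -
    toeplitz f hf g : FockSpace n p t) x) (g := g) (κ := shiftMajorant n t) hp1 ht1 measurable_shiftMajorant hct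
    g.differentiable.continuous.measurable ?_
  · rw [hcC] at key
    rw [sub_apply, FockSpace.norm_def, FockSpace.norm_def]
    refine (ENNReal.toReal_mono (ENNReal.mul_ne_top (ENNReal.mul_ne_top hC't
      ENNReal.ofReal_ne_top) g.memLp.2.ne) key).trans (le_of_eq ?_)
    rw [ENNReal.toReal_mul, ENNReal.toReal_mul, ENNReal.toReal_ofReal (norm_nonneg _)]
  · intro x
    rw [FockSpace.sub_apply, shiftOp_toeplitz, toeplitz_apply, toeplitz_apply, bergmanProj,
      bergmanProj, integral_gaussian_add ht1 _ z]
    have hi1 := integrable_gaussian_add ht1 z (integrable_bergman hp1 ht1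
      (memLp_bdd_mul (memLp_top_sub hf z) g.memLp) x)
    have hi0 := integrable_bergman hp1 ht1 (memLp_bdd_mul hf g.memLp) x
    rw [← integral_sub hi1 hi0]
    have hae : ∀ᵐ w, ‖f w‖ₑ ≤ eLpNorm f ∞ volume := by
      rw [eLpNorm_exponent_top]
      exact ae_le_eLpNormEssSup
    calc _ ≤ (∫⁻ w, ‖f w * (Complex.exp ((-(2 * (herm w z).re + normSq z) / t : ℝ)) *
          (Complex.exp (herm x (w + z) / (t : ℂ)) * g (w + z)) -
          Complex.exp (herm x w / (t : ℂ)) * g w)‖ₑ ∂(gaussian n t)) * weight t x := by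
          gcongr
          refine (enorm_integral_le_lintegral_enorm _).trans (lintegral_mono fun w => ?_)
          refine le_of_eq (congrArg _ ?_)
          simp only [add_sub_cancel_right, Complex.real_smul, Complex.ofReal_exp]
          ring
      _ = gconst n t * ∫⁻ w, ‖f w‖ₑ * (‖Complex.exp ((-(2 * (herm w z).re + normSq z) / t : ℝ)) *
          (Complex.exp (herm x (w + z) / (t : ℂ)) * g (w + z)) -
          Complex.exp (herm x w / (t : ℂ)) * g w‖ₑ *
          (ENNReal.ofReal (Real.exp (-normSq w / t)) * weight t x)) := by
          rw [lintegral_gaussian ht1, mul_assoc,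
            ← lintegral_mul_const' _ _ (by exact ENNReal.ofReal_ne_top)]
          simp only [enorm_mul, mul_assoc]
      _ ≤ gconst n t * ∫⁻ w, eLpNorm f ∞ volume *
          (gconst n t * ENNReal.ofReal (‖z‖ * Real.exp (2 * n / t)) *
          (shiftMajorant n t (x - w) *
            ∫⁻ y, shiftMajorant n t (w - y) * (‖g y‖ₑ * weight t y))) := by
          refine mul_le_mul_right (lintegral_mono_ae ?_) _
          filter_upwards [hae] with w hw
          exact mul_le_mul' hw (enorm_translate_sub_le hp1 ht1 g.memLp g.bergmanProj_eq hz x w)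
      _ = _ := by
          rw [lintegral_const_mul' _ _ hf.2.ne, lintegral_const_mul' _ _
            (ENNReal.mul_ne_top (gconst_ne_top t) ENNReal.ofReal_ne_top), hc]
          ring

/-! ### Operators with norm-continuous orbits -/

variable (n p t) in
/-- The operators `A` for which `z ↦ α_z(A)` is norm continuous. -/
def shiftContinuousAlg : NonUnitalSubalgebra ℂ (FockSpace n p t →L[ℂ] FockSpace n p t) where
  carrier := {A | Filter.Tendsto (fun z => shiftOp z A) (𝓝 0) (𝓝 A)}
  add_mem' := fun {A B} hA hB => by
    refine (hA.add hB).congr fun z => ?_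
    simp only [← shiftOpL_apply, map_add]
  zero_mem' := by
    refine tendsto_const_nhds.congr fun z => ?_
    rw [← shiftOpL_apply, map_zero]
  mul_mem' := fun {A B} hA hB => by
    refine (hA.mul hB).congr fun z => ?_
    rw [shiftOp_mul]
  smul_mem' := fun c A hA => by
    refine (hA.const_smul c).congr fun z => ?_
    simp only [← shiftOpL_apply, map_smul]

lemma mem_shiftContinuousAlg {A : FockSpace n p t →L[ℂ] FockSpace n p t} :
    A ∈ shiftContinuousAlg n p t ↔ Filter.Tendsto (fun z => shiftOp z A) (𝓝 0) (𝓝 A) := Iff.rfl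

lemma isClosed_shiftContinuousAlg :
    IsClosed (shiftContinuousAlg n p t : Set (FockSpace n p t →L[ℂ] FockSpace n p t)) := by
  refine isClosed_of_closure_subset fun A hA => ?_
  rw [SetLike.mem_coe, mem_shiftContinuousAlg, Metric.tendsto_nhds]
  intro ε hε
  obtain ⟨B, hB, hAB⟩ := Metric.mem_closure_iff.mp hA (ε / 3) (by positivity)
  rw [SetLike.mem_coe, mem_shiftContinuousAlg, Metric.tendsto_nhds] at hB
  filter_upwards [hB (ε / 3) (by positivity)] with z hz
  have h1 : dist (shiftOp z A) (shiftOp z B) ≤ dist A B := by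
    rw [dist_eq_norm, dist_eq_norm, ← shiftOpL_apply, ← shiftOpL_apply, ← map_sub]
    exact norm_shiftOp_le z _
  have h2 := dist_triangle4 (shiftOp z A) (shiftOp z B) B A
  rw [dist_comm B A] at h2
  linarith

/-- The right-hand side is a closed algebra, because `α_z` is multiplicative and contractive, so
only the generators need to be checked. -/
lemma fullToeplitzAlg_le_shiftContinuousAlg :
    fullToeplitzAlg n p t ≤ shiftContinuousAlg n p t := by
  refine NonUnitalSubalgebra.topologicalClosure_minimal
    (NonUnitalAlgebra.adjoin_le ?_) isClosed_shiftContinuousAlg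
  rintro _ ⟨f, -, hf, rfl⟩
  rw [SetLike.mem_coe, mem_shiftContinuousAlg, tendsto_iff_norm_sub_tendsto_zero]
  obtain ⟨C, hC⟩ := exists_norm_shiftOp_toeplitz_sub_le (p := p) (t := t) f hf
  have h0 : Filter.Tendsto (fun z : Cn n => C * ‖z‖) (𝓝 0) (𝓝 0) := by
    have : Continuous fun z : Cn n => C * ‖z‖ := by fun_prop
    simpa using this.tendsto 0
  refine squeeze_zero' (Filter.Eventually.of_forall fun _ => norm_nonneg _) ?_ h0
  filter_upwards [Metric.closedBall_mem_nhds (0 : Cn n) one_pos] with z hz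
  exact hC z (by simpa using hz)

/-- The group law together with contractivity of `α_w` transports continuity at the origin to every
point with the same modulus. -/
lemma uniformContinuous_shiftOp {A : FockSpace n p t →L[ℂ] FockSpace n p t}
    (hA : A ∈ shiftContinuousAlg n p t) : UniformContinuous fun z => shiftOp z A := by
  rw [mem_shiftContinuousAlg, Metric.tendsto_nhds_nhds] at hA
  rw [Metric.uniformContinuous_iff]
  intro ε hε
  obtain ⟨δ, hδ, h⟩ := hA ε hε
  refine ⟨δ, hδ, fun z w hzw => ?_⟩
  have h1 : shiftOp z A - shiftOp w A = shiftOp w (shiftOp (z - w) A - A) := by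
    have := map_sub (shiftOpL p t w) (shiftOp (z - w) A) A
    simp only [shiftOpL_apply, shiftOp_shiftOp, add_sub_cancel] at this
    exact this.symm
  rw [dist_eq_norm, h1]
  refine (norm_shiftOp_le _ _).trans_lt ?_
  rw [← dist_eq_norm]
  refine h ?_
  rwa [dist_zero_right, ← dist_eq_norm]

lemma uniformContinuous_berezin {A : FockSpace n p t →L[ℂ] FockSpace n p t}
    (hA : A ∈ shiftContinuousAlg n p t) : UniformContinuous (berezin A) := by
  have h : berezin A = berezinZero n p t ∘ (fun z => shiftOp z A) ∘ Neg.neg :=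
    funext fun z => berezin_eq_berezinZero A z
  rw [h]
  exact (berezinZero n p t).uniformContinuous.comp
    ((uniformContinuous_shiftOp hA).comp uniformContinuous_neg)

/-- The Berezin transform as a bounded continuous function. -/
def berezinBCF (A : FockSpace n p t →L[ℂ] FockSpace n p t)
    (hA : A ∈ shiftContinuousAlg n p t) : Cn n →ᵇ ℂ :=
  BoundedContinuousFunction.ofNormedAddCommGroup (berezin A)
    (uniformContinuous_berezin hA).continuous _ (norm_berezin_le A)

@[simp]
lemma coe_berezinBCF (A : FockSpace n p t →L[ℂ] FockSpace n p t)
    (hA : A ∈ shiftContinuousAlg n p t) : (berezinBCF A hA : Cn n → ℂ) = berezin A := rfl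

lemma berezinBCF_mem_BUC (A : FockSpace n p t →L[ℂ] FockSpace n p t)
    (hA : A ∈ shiftContinuousAlg n p t) : berezinBCF A hA ∈ BUC n :=
  uniformContinuous_berezin hA

end

/-! ### Gaussian convolution is injective on bounded continuous functions -/

lemma integrable_exp_absSum (ht : 0 < t) (R : ℝ) :
    Integrable (fun w : Cn n => Real.exp (R * absSum w)) (gaussian n t) := by
  have := isProbabilityMeasure_gaussian (n := n) (s := 2 * t / 2) (by positivity)
  have h := integrable_exp_mul (n := n) (p := 2) (h := fun _ => 1) (by norm_num) ht
    (memLp_const 1) R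
  simpa only [norm_one, mul_one, absSum] using h

lemma exists_eq_re_herm (L : StrongDual ℝ (Cn n)) : ∃ a : Cn n, ∀ z, L z = (herm z a).re := by
  -- The choice rests on `Re (ζ \overline a) = Re ζ Re a + Im ζ Im a`.
  refine ⟨fun i => ⟨L (Pi.single i 1), L (Pi.single i Complex.I)⟩, fun z => ?_⟩
  have hz : z = ∑ i, ((z i).re • (Pi.single i 1 : Cn n) +
      (z i).im • (Pi.single i Complex.I : Cn n)) := by
    ext1 j
    rw [Finset.sum_apply, Finset.sum_eq_single j]
    · simpa [mul_comm] using (Complex.re_add_im (z j)).symm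
    · intro b _ hb
      simp [Pi.single_eq_of_ne hb.symm]
    · simp
  conv_lhs => rw [hz]
  simp only [map_sum, map_add, map_smul, herm, Complex.re_sum, smul_eq_mul, Complex.mul_re,
    Complex.conj_re, Complex.conj_im]
  refine Finset.sum_congr rfl fun i _ => ?_
  ring

lemma herm_ofReal_smul_right (s : ℝ) (w a : Cn n) :
    herm w ((s : ℂ) • a) = s * herm w a := by
  simp [herm, Finset.mul_sum, mul_left_comm]

/-- This converts a Gaussian convolution into exponential moments of `φ dμ_t`: if the convolution
vanishes, so do all real exponential moments. -/
lemma integral_mul_exp_re_herm (ht : 0 < t) (φ : Cn n → ℝ) (x : Cn n) :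
    ∫ w, φ w * Real.exp (2 * (herm w x).re / t) ∂(gaussian n t) =
      Real.exp (normSq x / t) * ∫ w, φ (x + w) ∂(gaussian n t) := by
  rw [integral_gaussian_add ht _ x, ← integral_const_mul]
  refine integral_congr_ae (Filter.Eventually.of_forall fun w => ?_)
  simp only [smul_eq_mul]
  rw [mul_left_comm, ← Real.exp_add, mul_comm, add_comm w]
  congr 2
  rw [add_comm x, herm_add_left, Complex.add_re, herm_self, Complex.ofReal_re]
  ring

/-- The positive and negative parts of `φ` give two finite measures `P μ_t` and `N μ_t` with the
same finite exponential moments in every direction. Analytic continuation to the imaginary axis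
equates their characteristic functions, hence the measures, hence `P` and `N` almost everywhere;
continuity of `φ` does the rest. -/
lemma eq_zero_of_gaussian_convolution_real (ht : 0 < t) {φ : Cn n → ℝ} (hφ : Continuous φ)
    {C : ℝ} (hC : ∀ w, |φ w| ≤ C) (h : ∀ x, ∫ w, φ (x + w) ∂(gaussian n t) = 0) (w : Cn n) :
    φ w = 0 := by
  have := isProbabilityMeasure_gaussian (n := n) ht
  have hint : ∀ ψ : Cn n → ℝ, Continuous ψ → (∀ w, |ψ w| ≤ C) → ∀ a : Cn n,
      Integrable (fun w => ψ w * Real.exp ((herm w a).re)) (gaussian n t) := by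
    intro ψ hψ hψC a
    have hc : Continuous fun w : Cn n => herm w a := (differentiable_herm a).continuous
    refine ((integrable_exp_absSum ht ‖a‖).const_mul C).mono'
      (Continuous.aestronglyMeasurable (by fun_prop)) (Filter.Eventually.of_forall fun w => ?_)
    rw [norm_mul, Real.norm_eq_abs, Real.norm_of_nonneg (Real.exp_nonneg _)]
    have h1 := (Complex.re_le_norm _).trans (norm_herm_le_absSum_mul w a)
    have h2 := hψC w
    have h3 := (abs_nonneg _).trans h2
    gcongr
  have key : ∀ a : Cn n, ∫ w, φ w * Real.exp ((herm w a).re) ∂(gaussian n t) = 0 := fun a => by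
    -- The factor `t / 2` cancels the `2 / t` in the exponent.
    have h1 := integral_mul_exp_re_herm ht φ (((t / 2 : ℝ) : ℂ) • a)
    rw [h, mul_zero] at h1
    rw [← h1]
    refine integral_congr_ae (Filter.Eventually.of_forall fun w => ?_)
    simp only
    rw [herm_ofReal_smul_right, Complex.re_ofReal_mul]
    congr 2
    field_simp
  have hmaxc : ∀ ψ : Cn n → ℝ, Continuous ψ → (∀ w, |ψ w| ≤ C) →
      Continuous (fun w => max (ψ w) 0) ∧ (∀ w, |max (ψ w) 0| ≤ C) := fun ψ hψ hψC =>
    ⟨by fun_prop, fun w => by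
      rw [abs_of_nonneg (le_max_right _ _)]
      exact max_le ((le_abs_self _).trans (hψC w)) ((abs_nonneg _).trans (hψC w))⟩
  have hp1 := hmaxc φ hφ hC
  have hn1 := hmaxc (fun w => -φ w) hφ.neg (fun w => by rw [abs_neg]; exact hC w)
  set P : Cn n → ℝ := fun w => max (φ w) 0 with hP
  set N : Cn n → ℝ := fun w => max (-φ w) 0 with hN
  have hPN : ∀ w, P w - N w = φ w := fun w => by
    simp only [hP, hN]
    rcases le_total (φ w) 0 with h0 | h0
    · rw [max_eq_right h0, max_eq_left (by linarith)]; ring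
    · rw [max_eq_left h0, max_eq_right (by linarith)]; ring
  let M : (Cn n → ℝ) → Measure (Cn n) := fun ψ =>
    (gaussian n t).withDensity fun w => ENNReal.ofReal (ψ w)
  have hfin : ∀ ψ : Cn n → ℝ, Continuous ψ → (∀ w, |ψ w| ≤ C) → IsFiniteMeasure (M ψ) := by
    intro ψ hψ hψC
    refine isFiniteMeasure_withDensity_ofReal ?_
    refine (Integrable.of_bound (C := C) hψ.aestronglyMeasurable
      (Filter.Eventually.of_forall hψC)).2
  have hMi : ∀ ψ : Cn n → ℝ, Continuous ψ → (∀ w, 0 ≤ ψ w) → ∀ f : Cn n → ℝ,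
      (∫ w, f w ∂(M ψ) = ∫ w, ψ w * f w ∂(gaussian n t)) ∧
      (Integrable f (M ψ) ↔ Integrable (fun w => ψ w * f w) (gaussian n t)) := by
    intro ψ hψ h0 f
    constructor
    · rw [integral_withDensity_eq_integral_toReal_smul hψ.measurable.ennreal_ofReal
        (Filter.Eventually.of_forall fun _ => ENNReal.ofReal_lt_top)]
      simp only [ENNReal.toReal_ofReal (h0 _), smul_eq_mul]
    · rw [integrable_withDensity_iff_integrable_smul' hψ.measurable.ennreal_ofReal
        (Filter.Eventually.of_forall fun _ => ENNReal.ofReal_lt_top)]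
      simp only [ENNReal.toReal_ofReal (h0 _), smul_eq_mul]
  have hP0 : ∀ w, 0 ≤ P w := fun w => le_max_right _ _
  have hN0 : ∀ w, 0 ≤ N w := fun w => le_max_right _ _
  have := hfin P hp1.1 hp1.2
  have := hfin N hn1.1 hn1.2
  have hsmul : ∀ (s : ℝ) (a w : Cn n), s * (herm w a).re = (herm w ((s : ℂ) • a)).re := by
    intro s a w
    rw [herm_ofReal_smul_right, Complex.re_ofReal_mul]
  have hmgf : ∀ L : StrongDual ℝ (Cn n),
      ProbabilityTheory.mgf L (M P) = ProbabilityTheory.mgf L (M N) := by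
    intro L
    obtain ⟨a, ha⟩ := exists_eq_re_herm L
    ext s
    simp only [ProbabilityTheory.mgf, ha, hsmul]
    rw [(hMi P hp1.1 hP0 _).1, (hMi N hn1.1 hN0 _).1, ← sub_eq_zero,
      ← integral_sub (hint P hp1.1 hp1.2 _) (hint N hn1.1 hn1.2 _), ← key ((s : ℂ) • a)]
    simp only [← sub_mul, hPN]
  -- Finiteness of all moments makes the strip of analyticity the whole plane, so that it contains
  -- `Complex.I`.
  have hset : ∀ L : StrongDual ℝ (Cn n),
      ProbabilityTheory.integrableExpSet L (M P) = Set.univ := by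
    intro L
    obtain ⟨a, ha⟩ := exists_eq_re_herm L
    refine Set.eq_univ_of_forall fun s => ?_
    change Integrable _ _
    simp only [ha, hsmul]
    exact (hMi P hp1.1 hP0 _).2.mpr (hint P hp1.1 hp1.2 _)
  -- A side condition of the continuation theorem: the moment at `0` is the total mass.
  have hzero : M P = 0 ↔ M N = 0 := by
    have h0 := congrFun (hmgf 0) 0
    rw [ProbabilityTheory.mgf_zero', ProbabilityTheory.mgf_zero'] at h0
    rw [← Measure.measure_univ_eq_zero, ← Measure.measure_univ_eq_zero,
      ← measureReal_eq_zero_iff, ← measureReal_eq_zero_iff, h0]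
  have hMeq : M P = M N := by
    refine Measure.ext_of_charFunDual (funext fun L => ?_)
    have h1 := ProbabilityTheory.eqOn_complexMGF_of_mgf' (hmgf L) hzero
      (x := Complex.I) (by simp [hset L])
    simp only [ProbabilityTheory.complexMGF] at h1
    rw [charFunDual_apply, charFunDual_apply]
    simpa only [mul_comm] using h1
  have hae := (withDensity_eq_iff_of_sigmaFinite
    hp1.1.measurable.ennreal_ofReal.aemeasurable
    hn1.1.measurable.ennreal_ofReal.aemeasurable).mp hMeq
  have hae2 : φ =ᵐ[volume] fun _ => (0 : ℝ) := by
    filter_upwards [(absolutelyContinuous_gaussian ht).ae_eq hae] with w hw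
    have h2 : P w = N w := (ENNReal.ofReal_eq_ofReal_iff (hP0 w) (hN0 w)).mp hw
    rw [← hPN w, h2, sub_self]
  exact congrFun ((Continuous.ae_eq_iff_eq volume hφ continuous_const).mp hae2) w

lemma eq_zero_of_gaussian_convolution (ht : 0 < t) {φ : Cn n → ℂ} (hφ : Continuous φ)
    {C : ℝ} (hC : ∀ w, ‖φ w‖ ≤ C) (h : ∀ x, ∫ w, φ (x + w) ∂(gaussian n t) = 0) (w : Cn n) :
    φ w = 0 := by
  have := isProbabilityMeasure_gaussian (n := n) ht
  have hi : ∀ x, Integrable (fun w => φ (x + w)) (gaussian n t) := fun x =>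
    Integrable.of_bound (C := C) (Continuous.aestronglyMeasurable (by fun_prop))
      (Filter.Eventually.of_forall fun w => hC _)
  refine Complex.ext ?_ ?_
  · refine eq_zero_of_gaussian_convolution_real (φ := fun w => (φ w).re) ht (by fun_prop)
      (fun w => (Complex.abs_re_le_norm _).trans (hC w)) (fun x => ?_) w
    have := integral_re (hi x)
    simp only [h x] at this
    simpa using this
  · refine eq_zero_of_gaussian_convolution_real (φ := fun w => (φ w).im) ht (by fun_prop)
      (fun w => (Complex.abs_im_le_norm _).trans (hC w)) (fun x => ?_) w
    have := integral_im (hi x)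
    simp only [h x] at this
    simpa using this

/-! ### Gaussian averages of vector-valued functions and closed subspaces -/

section

variable {E : Type*} [NormedAddCommGroup E] [NormedSpace ℂ E]

/-- Hahn–Banach in the quotient by `S`, which is a normed space because `S` is closed. -/
lemma mem_of_forall_dual {S : Submodule ℂ E} (hS : IsClosed (S : Set E)) {x : E}
    (h : ∀ l : StrongDual ℂ E, (∀ y ∈ S, l y = 0) → l x = 0) : x ∈ S := by
  have : IsClosed (S : Set E) := hS
  have hq : S.mkQL x = 0 := by
    refine SeparatingDual.eq_zero_of_forall_dual_eq_zero (R := ℂ) fun f => ?_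
    refine h (f ∘L S.mkQL) fun y hy => ?_
    have : S.mkQL y = 0 := (Submodule.Quotient.mk_eq_zero S).mpr hy
    rw [ContinuousLinearMap.comp_apply, this, map_zero]
  exact (Submodule.Quotient.mk_eq_zero S).mp hq

lemma integrable_gaussian_of_bounded {E : Type*} [NormedAddCommGroup E] (ht : 0 < t) {u : Cn n → E} (hu : Continuous u) {C : ℝ}
    (hC : ∀ z, ‖u z‖ ≤ C) : Integrable u (gaussian n t) := by
  have := isProbabilityMeasure_gaussian (n := n) ht
  exact Integrable.of_bound (C := C) hu.aestronglyMeasurable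
      (Filter.Eventually.of_forall hC)

variable [CompleteSpace E]

lemma integral_gaussian_mem (ht : 0 < t) {u : Cn n → E} (hu : Continuous u) {C : ℝ}
    (hC : ∀ z, ‖u z‖ ≤ C) {S : Submodule ℂ E} (hS : IsClosed (S : Set E)) (h : ∀ z, u z ∈ S) :
    ∫ z, u z ∂(gaussian n t) ∈ S := by
  refine mem_of_forall_dual hS fun l hl => ?_
  rw [← l.integral_comp_comm (integrable_gaussian_of_bounded ht hu hC)]
  simp [hl _ (h _)]

/-- The Tauberian step. A functional `l` vanishing on `S` turns `u` into a bounded continuous scalar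
function whose Gaussian convolution is zero, hence `l (u 0) = 0`. -/
lemma apply_zero_mem_of_integral_gaussian_mem (ht : 0 < t) {u : Cn n → E} (hu : Continuous u)
    {C : ℝ} (hC : ∀ z, ‖u z‖ ≤ C) {S : Submodule ℂ E} (hS : IsClosed (S : Set E))
    (h : ∀ w, ∫ z, u (w + z) ∂(gaussian n t) ∈ S) : u 0 ∈ S := by
  refine mem_of_forall_dual hS fun l hl => ?_
  refine eq_zero_of_gaussian_convolution (φ := fun z => l (u z)) ht (by fun_prop)
    (C := ‖l‖ * C) (fun w => (l.le_opNorm _).trans (by gcongr; exact hC w)) (fun x => ?_) 0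
  rw [l.integral_comp_comm (integrable_gaussian_of_bounded (u := fun z => u (x + z)) ht
    (by fun_prop) (fun z => hC _))]
  exact hl _ (h x)

end

/-! ### Holomorphic families of kernels and evaluations -/

/-- Second-order Taylor remainder with a bound suited to `m = absSum w`. Of the `3 * β`, two parts
absorb the factor `(β m)²` and one comes from `exp ‖h * s‖`. -/
lemma norm_cexp_remainder_le {E s h : ℂ} {γ β m : ℝ} (hβ : 0 ≤ β) (hm : 0 ≤ m)
    (hE : ‖Complex.exp E‖ ≤ Real.exp (γ * m)) (hs : ‖s‖ ≤ β * m) (hh : ‖h‖ ≤ 1) :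
    ‖Complex.exp (E + h * s) - Complex.exp E - h * (s * Complex.exp E)‖ ≤
      ‖h‖ ^ 2 * Real.exp ((γ + 3 * β) * m) := by
  have e : Complex.exp (E + h * s) - Complex.exp E - h * (s * Complex.exp E) =
      Complex.exp E * (Complex.exp (h * s) - ∑ i ∈ Finset.range 2, (h * s) ^ i / (i.factorial)) := by
    rw [Complex.exp_add, Finset.sum_range_succ, Finset.sum_range_one]
    simp
    ring
  have hβm : 0 ≤ β * m := by positivity
  have h1 : ‖h * s‖ ≤ β * m := by
    rw [norm_mul]
    exact (mul_le_of_le_one_left (norm_nonneg _) hh).trans hs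
  have h2 : ‖h * s‖ ^ 2 ≤ ‖h‖ ^ 2 * Real.exp (β * m) ^ 2 := by
    rw [norm_mul, mul_pow]
    gcongr
    linarith [Real.add_one_le_exp (β * m)]
  rw [e, norm_mul]
  calc _ ≤ Real.exp (γ * m) * (‖h * s‖ ^ 2 * Real.exp ‖h * s‖) := by
        gcongr
        exact Complex.norm_exp_sub_sum_le_norm_mul_exp _ 2
    _ ≤ Real.exp (γ * m) * ((‖h‖ ^ 2 * Real.exp (β * m) ^ 2) * Real.exp (β * m)) := by gcongr
    _ = ‖h‖ ^ 2 * (Real.exp (γ * m) * (Real.exp (β * m) * Real.exp (β * m)) *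
          Real.exp (β * m)) := by ring
    _ = _ := by
        rw [← Real.exp_add, ← Real.exp_add, ← Real.exp_add]
        congr 2
        ring

lemma hasDerivAt_of_norm_remainder_le {F : Type*} [NormedAddCommGroup F] [NormedSpace ℂ F]
    {f : ℂ → F} {f' : F} {x : ℂ} {D : ℝ}
    (h : ∀ z : ℂ, ‖z‖ ≤ 1 → ‖f (x + z) - f x - z • f'‖ ≤ ‖z‖ ^ 2 * D) : HasDerivAt f f' x := by
  rw [hasDerivAt_iff_isLittleO_nhds_zero]
  have h1 : (fun z : ℂ => f (x + z) - f x - z • f') =O[𝓝 0] fun z : ℂ => z ^ 2 := by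
    refine Asymptotics.IsBigO.of_bound D ?_
    filter_upwards [Metric.closedBall_mem_nhds (0 : ℂ) one_pos] with z hz
    rw [norm_pow, mul_comm]
    exact h z (by simpa using hz)
  exact h1.trans_isLittleO (Asymptotics.isLittleO_pow_id one_lt_two)

lemma herm_conj_smul_right (c : ℂ) (w a : Cn n) : herm w (conj c • a) = c * herm w a := by
  simp [herm, Finset.mul_sum, mul_left_comm]

section

variable [hp : Fact (1 < p)] [ht : Fact (0 < t)]

lemma norm_herm_div_le_mul_absSum (z w : Cn n) :
    ‖herm z w / (t : ℂ)‖ ≤ ‖z‖ / t * absSum w := by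
  rw [norm_div, Complex.norm_real, Real.norm_of_nonneg ht.out.le, div_mul_eq_mul_div]
  have := ht.out
  gcongr
  exact norm_herm_le_mul_absSum z w

lemma norm_herm_div_le_absSum_mul (w z : Cn n) :
    ‖herm w z / (t : ℂ)‖ ≤ ‖z‖ / t * absSum w := by
  rw [norm_div, Complex.norm_real, Real.norm_of_nonneg ht.out.le, div_mul_eq_mul_div]
  have := ht.out
  gcongr
  exact norm_herm_le_absSum_mul w z

lemma norm_mul_exp_le {E s : ℂ} {γ β m : ℝ} (hE : ‖Complex.exp E‖ ≤ Real.exp (γ * m))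
    (hs : ‖s‖ ≤ β * m) : ‖s * Complex.exp E‖ ≤ 1 * Real.exp ((γ + β) * m) := by
  rw [norm_mul, one_mul, add_mul, add_comm, Real.exp_add]
  gcongr
  linarith [Real.add_one_le_exp (β * m)]

/-- The kernel is antiholomorphic in its base point; conjugating `l` restores holomorphy. The
derivative is found pointwise, and the quadratic remainder has exponential growth, so it is small in
the Fock norm. -/
lemma differentiable_expKernel_line (a b : Cn n) :
    Differentiable ℂ fun l : ℂ => (expKernel (a + conj l • b) : FockSpace n p t) := by
  intro l
  have ht1 := ht.out
  set v := a + conj l • b with hv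
  have hE : ∀ w : Cn n, ‖Complex.exp (herm w v / (t : ℂ))‖ ≤ Real.exp (‖v‖ / t * absSum w) :=
    fun w => norm_exp_herm_le' ht1 w v
  have hs : ∀ w : Cn n, ‖herm w b / (t : ℂ)‖ ≤ ‖b‖ / t * absSum w := fun w =>
    norm_herm_div_le_absSum_mul w b
  let d : FockSpace n p t := ofExpGrowth
    (fun w => herm w b / (t : ℂ) * Complex.exp (herm w v / (t : ℂ)))
    (by
      have := differentiable_herm b
      have := differentiable_herm v
      fun_prop) 1 (‖v‖ / t + ‖b‖ / t) (fun w => norm_mul_exp_le (hE w) (hs w))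
  obtain ⟨D, -, hD⟩ := exists_norm_le_of_expGrowth n p t (‖v‖ / t + 3 * (‖b‖ / t))
  refine (hasDerivAt_of_norm_remainder_le (f' := d) (D := D) fun z hz => ?_).differentiableAt
  refine hD _ _ (by positivity) fun w => ?_
  have h := norm_cexp_remainder_le (by positivity) (absSum_nonneg w) (hE w) (hs w) hz
  convert! h using 2
  rw [FockSpace.sub_apply, FockSpace.sub_apply, FockSpace.smul_apply, expKernel_apply,
    expKernel_apply, ofExpGrowth_apply]
  congr 4
  simp only [hv, map_add, add_smul, herm_add_right, herm_conj_smul_right]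
  ring

lemma integrable_mul_of_expGrowth {k : Cn n → ℂ} (hk : Continuous k) {c R : ℝ}
    (hkc : ∀ w, ‖k w‖ ≤ c * Real.exp (R * absSum w)) (f : FockSpace n p t) :
    Integrable (fun w => k w * f w) (gaussian n t) :=
  ((integrable_exp_mul hp.out ht.out f.memLp R).const_mul c).mono'
    (hk.mul f.differentiable.continuous).aestronglyMeasurable
    (Filter.Eventually.of_forall fun w => by
      rw [norm_mul, ← mul_assoc]
      exact mul_le_mul_of_nonneg_right (hkc w) (norm_nonneg _))

variable (p) in
/-- Integration against a function of exponential growth, as a functional on the Fock space. -/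
def expPairing (k : Cn n → ℂ) (hk : Continuous k) (c R : ℝ)
    (hkc : ∀ w, ‖k w‖ ≤ c * Real.exp (R * absSum w)) : FockSpace n p t →L[ℂ] ℂ :=
  LinearMap.mkContinuous
    { toFun := fun f => ∫ w, k w * f w ∂(gaussian n t)
      map_add' := fun f g => by
        rw [← integral_add (integrable_mul_of_expGrowth hk hkc f)
          (integrable_mul_of_expGrowth hk hkc g)]
        simp only [FockSpace.add_apply, mul_add]
      map_smul' := fun c f => by
        rw [RingHom.id_apply, smul_eq_mul, ← integral_const_mul]
        simp only [FockSpace.smul_apply, mul_left_comm] }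
    (c * (exists_integral_exp_mul_le n hp.out ht.out R).choose) (fun f => by
      have hC := (exists_integral_exp_mul_le n hp.out ht.out R).choose_spec.2 f f.memLp
      have hc : 0 ≤ c := by
        have h0 := (norm_nonneg _).trans (hkc 0)
        exact nonneg_of_mul_nonneg_left h0 (Real.exp_pos _)
      have hi := (integrable_exp_mul hp.out ht.out f.memLp R).const_mul c
      rw [← FockSpace.norm_def] at hC
      rw [mul_assoc]
      refine (norm_integral_le_integral_norm _).trans (le_trans ?_
        (mul_le_mul_of_nonneg_left hC hc))
      rw [← integral_const_mul]
      refine integral_mono_of_nonneg (Filter.Eventually.of_forall fun _ => norm_nonneg _) hi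
        (Filter.Eventually.of_forall fun w => ?_)
      simp only [norm_mul]
      rw [← mul_assoc]
      exact mul_le_mul_of_nonneg_right (hkc w) (norm_nonneg _))

lemma expPairing_apply (k : Cn n → ℂ) (hk : Continuous k) (c R : ℝ)
    (hkc : ∀ w, ‖k w‖ ≤ c * Real.exp (R * absSum w)) (f : FockSpace n p t) :
    expPairing p k hk c R hkc f = ∫ w, k w * f w ∂(gaussian n t) := rfl

lemma norm_expPairing_le (k : Cn n → ℂ) (hk : Continuous k) (c R : ℝ)
    (hkc : ∀ w, ‖k w‖ ≤ c * Real.exp (R * absSum w)) (hc : 0 ≤ c) :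
    ‖(expPairing p k hk c R hkc : FockSpace n p t →L[ℂ] ℂ)‖ ≤
      c * (exists_integral_exp_mul_le n hp.out ht.out R).choose :=
  LinearMap.mkContinuous_norm_le _
    (mul_nonneg hc (exists_integral_exp_mul_le n hp.out ht.out R).choose_spec.1) _

omit hp ht in
lemma continuous_herm_right (z : Cn n) : Continuous fun w : Cn n => herm z w := by
  unfold herm
  fun_prop

lemma evalCLM_eq_integral (x : Cn n) (f : FockSpace n p t) :
    evalCLM x f = ∫ w, Complex.exp (herm x w / (t : ℂ)) * f w ∂(gaussian n t) :=
  (congrFun f.bergmanProj_eq x).symm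

/-- Evaluation is pairing with a kernel, so the same remainder estimate applies, now in the dual
norm. -/
lemma differentiable_evalCLM_line (a b : Cn n) :
    Differentiable ℂ fun l : ℂ => (evalCLM (a + l • b) : FockSpace n p t →L[ℂ] ℂ) := by
  intro l
  have ht1 := ht.out
  set v := a + l • b with hv
  have hE : ∀ w : Cn n, ‖Complex.exp (herm v w / (t : ℂ))‖ ≤ Real.exp (‖v‖ / t * absSum w) :=
    fun w => norm_exp_herm_le ht1 v w
  have hs : ∀ w : Cn n, ‖herm b w / (t : ℂ)‖ ≤ ‖b‖ / t * absSum w := fun w =>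
    norm_herm_div_le_mul_absSum b w
  have hcv := continuous_herm_right v
  have hcb := continuous_herm_right b
  have hdb : ∀ w : Cn n, ‖herm b w / (t : ℂ) * Complex.exp (herm v w / (t : ℂ))‖ ≤
      1 * Real.exp ((‖v‖ / t + ‖b‖ / t) * absSum w) := fun w => norm_mul_exp_le (hE w) (hs w)
  let d : FockSpace n p t →L[ℂ] ℂ := expPairing p
    (fun w => herm b w / (t : ℂ) * Complex.exp (herm v w / (t : ℂ)))
    (by fun_prop) 1 (‖v‖ / t + ‖b‖ / t) hdb
  refine (hasDerivAt_of_norm_remainder_le (f' := d)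
    (D := (exists_integral_exp_mul_le n hp.out ht.out (‖v‖ / t + 3 * (‖b‖ / t))).choose)
    fun z hz => ?_).differentiableAt
  have hrem : ∀ w : Cn n, ‖Complex.exp (herm v w / (t : ℂ) + z * (herm b w / (t : ℂ))) -
      Complex.exp (herm v w / (t : ℂ)) -
      z * (herm b w / (t : ℂ) * Complex.exp (herm v w / (t : ℂ)))‖ ≤
      ‖z‖ ^ 2 * Real.exp ((‖v‖ / t + 3 * (‖b‖ / t)) * absSum w) := fun w =>
    norm_cexp_remainder_le (by positivity) (absSum_nonneg w) (hE w) (hs w) hz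
  convert! norm_expPairing_le (p := p) (t := t) _ (by fun_prop) _ _ hrem (by positivity) using 2
  ext1 f
  have hexp : ∀ w, herm (a + (l + z) • b) w / (t : ℂ) =
      herm v w / (t : ℂ) + z * (herm b w / (t : ℂ)) := fun w => by
    simp only [hv, add_smul, herm_add_left, herm_smul_left]
    ring
  have hb1 : ∀ w : Cn n, ‖Complex.exp (herm v w / (t : ℂ) + z * (herm b w / (t : ℂ)))‖ ≤
      1 * Real.exp (‖a + (l + z) • b‖ / t * absSum w) := fun w => by
    rw [← hexp, one_mul]
    exact norm_exp_herm_le ht1 _ w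
  have hb0 : ∀ w : Cn n, ‖Complex.exp (herm v w / (t : ℂ))‖ ≤
      1 * Real.exp (‖v‖ / t * absSum w) := fun w => by rw [one_mul]; exact hE w
  have hi1 := integrable_mul_of_expGrowth (by fun_prop) hb1 f
  have hi0 := integrable_mul_of_expGrowth (by fun_prop) hb0 f
  have hi2 := integrable_mul_of_expGrowth (by fun_prop) hdb f
  rw [sub_apply, sub_apply, smul_apply,
    expPairing_apply, expPairing_apply, evalCLM_eq_integral, evalCLM_eq_integral, smul_eq_mul,
    ← integral_const_mul]
  simp only [hexp]
  rw [← integral_sub hi1 hi0]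
  refine (integral_sub (hi1.sub hi0) (hi2.const_mul z)).symm.trans ?_
  refine integral_congr_ae (Filter.Eventually.of_forall fun w => ?_)
  simp only [Pi.sub_apply]
  ring

/-! ### Density of the kernels -/

lemma continuous_expKernel : Continuous (expKernel : Cn n → FockSpace n p t) := by
  have ht1 := ht.out
  refine continuous_iff_continuousAt.mpr fun a => ?_
  obtain ⟨D, -, hD⟩ := exists_norm_le_of_expGrowth n p t (‖a‖ / t + 2 * (1 / t))
  rw [ContinuousAt, tendsto_iff_norm_sub_tendsto_zero]
  have h0 : Filter.Tendsto (fun z : Cn n => ‖z - a‖ * D) (𝓝 a) (𝓝 0) := by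
    have : Continuous fun z : Cn n => ‖z - a‖ * D := by fun_prop
    simpa using this.tendsto a
  refine squeeze_zero' (Filter.Eventually.of_forall fun _ => norm_nonneg _) ?_ h0
  filter_upwards [Metric.closedBall_mem_nhds a one_pos] with z hz
  have hz1 : ‖z - a‖ ≤ 1 := by rwa [← dist_eq_norm]
  refine hD _ _ (norm_nonneg _) fun w => ?_
  rw [FockSpace.sub_apply, expKernel_apply, expKernel_apply]
  have e : Complex.exp (herm w z / (t : ℂ)) - Complex.exp (herm w a / (t : ℂ)) =
      Complex.exp (herm w a / (t : ℂ)) * (Complex.exp (herm w (z - a) / (t : ℂ)) - 1) := by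
    rw [mul_sub, ← Complex.exp_add, herm_sub_right, mul_one]
    congr 2
    ring
  have hm := absSum_nonneg w
  have h1 : ‖herm w (z - a) / (t : ℂ)‖ ≤ ‖z - a‖ * (1 / t * absSum w) := by
    convert! norm_herm_div_le_absSum_mul (t := t) w (z - a) using 1
    ring
  have h2 : ‖z - a‖ * (1 / t * absSum w) ≤ 1 / t * absSum w :=
    mul_le_of_le_one_left (by positivity) hz1
  rw [e, norm_mul]
  calc _ ≤ Real.exp (‖a‖ / t * absSum w) * ((‖z - a‖ * (1 / t * absSum w)) *
        Real.exp (1 / t * absSum w)) := by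
        gcongr
        · exact norm_exp_herm_le' ht1 w a
        · refine (norm_cexp_sub_one_le _).trans ?_
          gcongr
          exact h1.trans h2
    _ ≤ Real.exp (‖a‖ / t * absSum w) * ((‖z - a‖ * Real.exp (1 / t * absSum w)) *
        Real.exp (1 / t * absSum w)) := by
        gcongr
        linarith [Real.add_one_le_exp (1 / t * absSum w)]
    _ = ‖z - a‖ * (Real.exp (‖a‖ / t * absSum w) * (Real.exp (1 / t * absSum w) *
        Real.exp (1 / t * absSum w))) := by ring
    _ = _ := by
        rw [← Real.exp_add, ← Real.exp_add]
        congr 2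
        ring

/-- Here `P_t h` is the vector-valued integral `∫ h(w) K_w dμ_t(w)`; compact support makes it
converge in the Fock space. -/
lemma projFock_mem_of_expKernel_mem {S : Submodule ℂ (FockSpace n p t)}
    (hS : IsClosed (S : Set (FockSpace n p t))) (hK : ∀ a, expKernel a ∈ S) {h : Cn n → ℂ}
    (hc : Continuous h) (hs : HasCompactSupport h)
    (hh : MemLp h (ENNReal.ofReal p) (gaussian n (2 * t / p))) : projFock h hh ∈ S := by
  have := isProbabilityMeasure_gaussian (n := n) ht.out
  have hi : Integrable (fun w => h w • (expKernel w : FockSpace n p t)) (gaussian n t) :=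
    (hc.smul continuous_expKernel).integrable_of_hasCompactSupport hs.smul_right
  have e : projFock h hh = ∫ w, h w • (expKernel w : FockSpace n p t) ∂(gaussian n t) := by
    refine FockSpace.ext fun x => ?_
    have h1 := (evalCLM x).integral_comp_comm hi
    simp only [evalCLM_apply, FockSpace.smul_apply, expKernel_apply] at h1
    rw [← h1]
    simp only [mul_comm (h _)]
    rfl
  rw [e]
  refine mem_of_forall_dual hS fun l hl => ?_
  rw [← l.integral_comp_comm hi]
  simp [hl _ (hK _)]

/-- Density of the kernels: `g = P_t g` is approximated by `P_t h` with `h` continuous of compact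
support, as `P_t` is bounded. -/
lemma mem_of_expKernel_mem {S : Submodule ℂ (FockSpace n p t)}
    (hS : IsClosed (S : Set (FockSpace n p t))) (hK : ∀ a, expKernel a ∈ S)
    (g : FockSpace n p t) : g ∈ S := by
  have hp0 : 0 < p := by have := hp.out; linarith
  have ht0 := ht.out
  have := isProbabilityMeasure_gaussian (n := n) (s := 2 * t / p) (by positivity)
  rw [← SetLike.mem_coe, ← hS.closure_eq, Metric.mem_closure_iff]
  intro ε hε
  set M := (projBound n t).toReal with hM
  have hM0 : 0 ≤ M := ENNReal.toReal_nonneg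
  obtain ⟨h, hs, hle, hc, hh⟩ := g.memLp.exists_hasCompactSupport_eLpNorm_sub_le
    ENNReal.ofReal_ne_top (ε := ENNReal.ofReal (ε / (2 * (M + 1)))) (by
      simp only [ne_eq, ENNReal.ofReal_eq_zero, not_le]
      positivity)
  refine ⟨projFock h hh, projFock_mem_of_expKernel_mem hS hK hc hs hh, ?_⟩
  have h1 := norm_projFock_sub_le (t := t) g.memLp hh
  rw [projFock_self] at h1
  rw [dist_eq_norm]
  have h2 : (eLpNorm ((g : Cn n → ℂ) - h) (ENNReal.ofReal p) (gaussian n (2 * t / p))).toReal ≤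
      ε / (2 * (M + 1)) := ENNReal.toReal_le_of_le_ofReal (by positivity) hle
  calc _ ≤ M * (ε / (2 * (M + 1))) := h1.trans (by gcongr)
    _ ≤ (M + 1) * (ε / (2 * (M + 1))) := by gcongr; linarith
    _ = ε / 2 := by field_simp
    _ < ε := by linarith

/-! ### Injectivity of the Berezin transform -/

/-- On the complexified line, `l ↦ (B K_{a + \overline l b})(a + l b)` is entire and, for real `l`,
only sees the diagonal, where it vanishes. By the identity theorem it vanishes everywhere, and the
lines reach every pair of points. -/
lemma eq_zero_of_berezin_eq_zero {B : FockSpace n p t →L[ℂ] FockSpace n p t}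
    (hB : ∀ z, berezin B z = 0) : B = 0 := by
  have hdiag : ∀ v, B (expKernel v) v = 0 := fun v => by
    have := hB v
    rw [berezin_eq_expKernel] at this
    exact (mul_eq_zero.mp this).resolve_left (Complex.exp_ne_zero _)
  have hline : ∀ a b : Cn n, ∀ l : ℂ, B (expKernel (a + conj l • b)) (a + l • b) = 0 := by
    intro a b l
    set F : ℂ → ℂ := fun l => evalCLM (a + l • b) (B (expKernel (a + conj l • b))) with hF
    have hd : Differentiable ℂ F := (differentiable_evalCLM_line (p := p) (t := t) a b).clm_apply
      (B.differentiable.comp (differentiable_expKernel_line a b))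
    have hfreq : ∃ᶠ z in 𝓝[≠] (0 : ℂ), F z = (fun _ => (0 : ℂ)) z := by
      have htend : Filter.Tendsto (fun x : ℝ => (x : ℂ)) (𝓝[≠] 0) (𝓝[≠] 0) := by
        refine tendsto_nhdsWithin_iff.mpr ⟨?_, ?_⟩
        · exact (Complex.continuous_ofReal.tendsto' 0 0 Complex.ofReal_zero).mono_left
            nhdsWithin_le_nhds
        · filter_upwards [self_mem_nhdsWithin] with x hx
          simpa using hx
      refine htend.frequently (Filter.Eventually.frequently (Filter.Eventually.of_forall ?_))
      intro x
      simp only [hF, Complex.conj_ofReal, evalCLM_apply, hdiag]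
    exact AnalyticOnNhd.eqOn_of_preconnected_of_frequently_eq
      (hd.differentiableOn.analyticOnNhd isOpen_univ) (fun _ _ => analyticAt_const)
      isPreconnected_univ (Set.mem_univ 0) hfreq (Set.mem_univ l)
  have hker : ∀ c : Cn n, B (expKernel c) = 0 := fun c => by
    refine FockSpace.ext fun d => ?_
    -- At `l = i` this `a` and `b` give `a - i b = c` and `a + i b = d`.
    have h1 := hline ((1 / 2 : ℂ) • (c + d)) ((1 / (2 * Complex.I)) • (d - c)) Complex.I
    rw [Complex.conj_I, smul_smul, smul_smul] at h1
    have e1 : -Complex.I * (1 / (2 * Complex.I)) = -(1 / 2) := by field_simp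
    have e2 : Complex.I * (1 / (2 * Complex.I)) = 1 / 2 := by field_simp
    rw [e1, e2] at h1
    have e3 : (1 / 2 : ℂ) • (c + d) + -(1 / 2 : ℂ) • (d - c) = c := by module
    have e4 : (1 / 2 : ℂ) • (c + d) + (1 / 2 : ℂ) • (d - c) = d := by module
    rw [e3, e4] at h1
    exact h1
  ext1 g
  exact mem_of_expKernel_mem (S := LinearMap.ker (B : FockSpace n p t →ₗ[ℂ] FockSpace n p t))
    B.isClosed_ker hker g

/-! ### Toeplitz operators with Berezin transforms as symbols -/

omit hp ht in
lemma integral_gaussian_neg {E : Type*} [NormedAddCommGroup E] [NormedSpace ℝ E] {s : ℝ}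
    (hs : 0 < s) (h : Cn n → E) :
    ∫ w, h (-w) ∂(gaussian n s) = ∫ w, h w ∂(gaussian n s) := by
  rw [integral_gaussian hs, integral_gaussian hs,
    ← integral_neg_eq_self (fun w => gaussianDensity n s w • h w)]
  simp only [gaussianDensity, normSq_neg]

/-- At the origin the kernel is `1`, so the value is the mean of `f`; covariance carries this to
every `z`. -/
lemma berezin_toeplitz (f : Cn n → ℂ) (hf : MemLp f ∞ volume) (z : Cn n) :
    berezin (toeplitz f hf : FockSpace n p t →L[ℂ] FockSpace n p t) z =
      ∫ w, f (z - w) ∂(gaussian n t) := by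
  have h0 : ∀ (f : Cn n → ℂ) (hf : MemLp f ∞ volume),
      berezin (toeplitz f hf : FockSpace n p t →L[ℂ] FockSpace n p t) 0 =
        ∫ w, f w ∂(gaussian n t) := fun f hf => by
    rw [berezin_eq_expKernel, toeplitz_apply, bergmanProj]
    simp [herm, normSq]
  have h1 := berezin_shiftOp (toeplitz f hf : FockSpace n p t →L[ℂ] FockSpace n p t) (-z) 0
  rw [zero_sub, neg_neg, shiftOp_toeplitz, h0] at h1
  rw [← h1, ← integral_gaussian_neg ht.out]
  refine integral_congr_ae (Filter.Eventually.of_forall fun w => ?_)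
  simp only
  congr 1
  abel

lemma berezin_eq_clm (A : FockSpace n p t →L[ℂ] FockSpace n p t) (z : Cn n) :
    berezin A z = (berezinZero n p t ∘L shiftOpL p t (-z)) A :=
  berezin_eq_berezinZero A z

lemma integrable_shiftOp {A : FockSpace n p t →L[ℂ] FockSpace n p t}
    (hA : A ∈ shiftContinuousAlg n p t) : Integrable (fun z => shiftOp z A) (gaussian n t) :=
  integrable_gaussian_of_bounded ht.out (uniformContinuous_shiftOp hA).continuous
    fun z => norm_shiftOp_le z A

/-- Both sides have Berezin transform `z ↦ ∫ Ã(z - w) dμ_t(w)`, so injectivity identifies them. -/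
lemma toeplitz_berezin {A : FockSpace n p t →L[ℂ] FockSpace n p t}
    (hA : A ∈ shiftContinuousAlg n p t) (hf : MemLp (berezin A) ∞ volume) :
    toeplitz (berezin A) hf = ∫ z, shiftOp z A ∂(gaussian n t) := by
  rw [← sub_eq_zero]
  refine eq_zero_of_berezin_eq_zero fun z => ?_
  rw [berezin_eq_clm, map_sub, ← ContinuousLinearMap.integral_comp_comm _ (integrable_shiftOp hA)]
  simp only [← berezin_eq_clm, berezin_shiftOp, berezin_toeplitz, sub_self]

end

/-! ### Symbols in `BUC` -/

lemma memLp_top_bcf (f : Cn n →ᵇ ℂ) : MemLp f ∞ (volume : Measure (Cn n)) :=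
  memLp_top_of_bound f.continuous.aestronglyMeasurable ‖f‖
    (Filter.Eventually.of_forall f.norm_coe_le_norm)

lemma eLpNorm_top_bcf_le (f : Cn n →ᵇ ℂ) :
    eLpNorm f ∞ (volume : Measure (Cn n)) ≤ ENNReal.ofReal ‖f‖ := by
  rw [eLpNorm_exponent_top]
  refine eLpNormEssSup_le_of_ae_bound (Filter.Eventually.of_forall f.norm_coe_le_norm)

lemma isClosed_BUC : IsClosed (BUC n : Set (Cn n →ᵇ ℂ)) := by
  refine isClosed_of_closure_subset fun f hf => ?_
  change UniformContinuous f
  rw [Metric.uniformContinuous_iff]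
  intro ε hε
  obtain ⟨g, hg, hfg⟩ := Metric.mem_closure_iff.mp hf (ε / 3) (by positivity)
  have hg' : UniformContinuous g := hg
  obtain ⟨δ, hδ, h⟩ := Metric.uniformContinuous_iff.mp hg' (ε / 3) (by positivity)
  refine ⟨δ, hδ, fun a b hab => ?_⟩
  have h1 := (BoundedContinuousFunction.dist_coe_le_dist (f := f) (g := g) a).trans_lt hfg
  have h2 := (BoundedContinuousFunction.dist_coe_le_dist (f := f) (g := g) b).trans_lt hfg
  have h3 := dist_triangle4 (f a) (g a) (g b) (f b)
  rw [dist_comm (g b)] at h3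
  linarith [h hab]

@[simp]
lemma shiftFun_apply (z : Cn n) (f : Cn n →ᵇ ℂ) (w : Cn n) : shiftFun z f w = f (w - z) := rfl

lemma norm_shiftFun_le (z : Cn n) (f : Cn n →ᵇ ℂ) : ‖shiftFun z f‖ ≤ ‖f‖ :=
  (BoundedContinuousFunction.norm_le (norm_nonneg _)).mpr fun w => f.norm_coe_le_norm (w - z)

/-- Translation as a continuous linear map. -/
def shiftFunL (z : Cn n) : (Cn n →ᵇ ℂ) →L[ℂ] (Cn n →ᵇ ℂ) :=
  LinearMap.mkContinuous
    { toFun := shiftFun z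
      map_add' := fun _ _ => rfl
      map_smul' := fun _ _ => rfl }
    1 (fun f => by rw [one_mul]; exact norm_shiftFun_le z f)

lemma shiftFun_shiftFun (z w : Cn n) (f : Cn n →ᵇ ℂ) :
    shiftFun z (shiftFun w f) = shiftFun (z + w) f := by
  ext x
  simp only [shiftFun_apply, sub_sub]

/-- This is where uniform continuity of symbols matters: it makes orbits continuous in the supremum
norm, so that they can be averaged. -/
lemma continuous_shiftFun {f : Cn n →ᵇ ℂ} (hf : f ∈ BUC n) :
    Continuous fun z => shiftFun z f := by
  have hf' : UniformContinuous f := hf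
  rw [Metric.continuous_iff]
  intro a ε hε
  obtain ⟨δ, hδ, h⟩ := Metric.uniformContinuous_iff.mp hf' (ε / 2) (by positivity)
  refine ⟨δ, hδ, fun z hz => lt_of_le_of_lt ?_ (half_lt_self hε)⟩
  refine (BoundedContinuousFunction.dist_le (by positivity)).mpr fun w => (h ?_).le
  change dist (w - z) (w - a) < δ
  rwa [dist_sub_left]

section

variable [hp : Fact (1 < p)] [ht : Fact (0 < t)]

variable (p t) in
/-- The Toeplitz quantization of bounded continuous symbols. -/
def toeplitzL : (Cn n →ᵇ ℂ) →L[ℂ] (FockSpace n p t →L[ℂ] FockSpace n p t) :=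
  LinearMap.mkContinuous
    { toFun := fun f => toeplitz f (memLp_top_bcf f)
      map_add' := fun f g => by
        ext1 h
        refine FockSpace.ext fun z => ?_
        have hf := integrable_bergman hp.out ht.out (memLp_bdd_mul (memLp_top_bcf f) h.memLp) z
        have hg := integrable_bergman hp.out ht.out (memLp_bdd_mul (memLp_top_bcf g) h.memLp) z
        refine Eq.trans ?_ (integral_add hf hg)
        refine integral_congr_ae (Filter.Eventually.of_forall fun w => ?_)
        change _ * ((f w + g w) * h w) = _ * (f w * h w) + _ * (g w * h w)
        ring
      map_smul' := fun c f => by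
        ext1 h
        refine FockSpace.ext fun z => ?_
        refine Eq.trans ?_ (integral_const_mul c _)
        refine integral_congr_ae (Filter.Eventually.of_forall fun w => ?_)
        change _ * ((c * f w) * h w) = c * (_ * (f w * h w))
        ring }
    (projBound n t).toReal (fun f => by
      have h : ‖(toeplitz f (memLp_top_bcf f) : FockSpace n p t →L[ℂ] FockSpace n p t)‖ ≤
          (projBound n t * eLpNorm f ∞ volume).toReal :=
        LinearMap.mkContinuous_norm_le _ ENNReal.toReal_nonneg _
      refine h.trans ?_
      rw [ENNReal.toReal_mul]
      gcongr
      exact ENNReal.toReal_le_of_le_ofReal (norm_nonneg _) (eLpNorm_top_bcf_le f))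

lemma toeplitz_mem_shiftContinuousAlg (f : Cn n → ℂ) (hf : MemLp f ∞ volume) :
    (toeplitz f hf : FockSpace n p t →L[ℂ] FockSpace n p t) ∈ shiftContinuousAlg n p t :=
  fullToeplitzAlg_le_shiftContinuousAlg
    (subset_closure (NonUnitalAlgebra.subset_adjoin ℂ ⟨f, hf, hf, rfl⟩))

variable (n p t) in
/-- The Berezin transform as a continuous linear map. -/
def berezinL : (shiftContinuousAlg n p t).toSubmodule →L[ℂ] (Cn n →ᵇ ℂ) :=
  LinearMap.mkContinuous
    { toFun := fun A => berezinBCF A.1 A.2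
      map_add' := fun A B => by
        ext z
        change berezin (A.1 + B.1) z = berezin A.1 z + berezin B.1 z
        simp only [berezin_eq_clm, map_add]
      map_smul' := fun c A => by
        ext z
        change berezin (c • A.1) z = c • berezin A.1 z
        simp only [berezin_eq_clm, map_smul] }
    ‖berezinZero n p t‖ (fun A =>
      (BoundedContinuousFunction.norm_le (by positivity)).mpr fun z => norm_berezin_le A.1 z)

lemma toeplitzL_berezinBCF {A : FockSpace n p t →L[ℂ] FockSpace n p t}
    (hA : A ∈ shiftContinuousAlg n p t) :
    toeplitzL p t (berezinBCF A hA) = ∫ z, shiftOp z A ∂(gaussian n t) :=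
  toeplitz_berezin hA (memLp_top_bcf (berezinBCF A hA))

lemma integral_shiftFun (s : ℝ) (hs : 0 < s) {f : Cn n →ᵇ ℂ} (hf : f ∈ BUC n) (x : Cn n) :
    (∫ z, shiftFun z f ∂(gaussian n s)) x = ∫ z, f (x - z) ∂(gaussian n s) := by
  have h := (BoundedContinuousFunction.evalCLM ℂ x).integral_comp_comm
    (integrable_gaussian_of_bounded hs (continuous_shiftFun hf) fun z => norm_shiftFun_le z f)
  exact h.symm

lemma berezinBCF_toeplitz {f : Cn n →ᵇ ℂ} (hf : f ∈ BUC n) :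
    berezinBCF (toeplitz f (memLp_top_bcf f) : FockSpace n p t →L[ℂ] FockSpace n p t)
      (toeplitz_mem_shiftContinuousAlg _ _) = ∫ z, shiftFun z f ∂(gaussian n t) := by
  ext x
  rw [integral_shiftFun t ht.out hf, coe_berezinBCF, berezin_toeplitz]

/-! ### The correspondence -/

variable {𝒮 : Submodule ℂ (FockSpace n p t →L[ℂ] FockSpace n p t)}

lemma berezinBCF_mem_berezinSpan {A : FockSpace n p t →L[ℂ] FockSpace n p t}
    (hA : A ∈ shiftContinuousAlg n p t) (hA𝒮 : A ∈ 𝒮) :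
    berezinBCF A hA ∈ berezinSpan (𝒮 : Set (FockSpace n p t →L[ℂ] FockSpace n p t)) :=
  subset_closure (Submodule.subset_span ⟨A, hA𝒮, rfl⟩)

lemma berezinSpan_le (h𝒮 : ∀ A ∈ 𝒮, A ∈ shiftContinuousAlg n p t)
    {D : Submodule ℂ (Cn n →ᵇ ℂ)} (hD : IsClosed (D : Set (Cn n →ᵇ ℂ)))
    (h : ∀ (A) (hA : A ∈ 𝒮), berezinBCF A (h𝒮 A hA) ∈ D) :
    berezinSpan (𝒮 : Set (FockSpace n p t →L[ℂ] FockSpace n p t)) ≤ D := by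
  refine Submodule.topologicalClosure_minimal _ (Submodule.span_le.mpr ?_) hD
  rintro g ⟨A, hA, hg⟩
  have : g = berezinBCF A (h𝒮 A hA) := DFunLike.coe_injective hg
  rw [this]
  exact h A hA

lemma isClosedInvariantBUC_berezinSpan (h𝒮 : ∀ A ∈ 𝒮, A ∈ shiftContinuousAlg n p t)
    (hshift : ∀ z : Cn n, ∀ A ∈ 𝒮, shiftOp z A ∈ 𝒮) :
    IsClosedInvariantBUC
      (berezinSpan (𝒮 : Set (FockSpace n p t →L[ℂ] FockSpace n p t))) where
  le_BUC := berezinSpan_le h𝒮 isClosed_BUC fun A hA => berezinBCF_mem_BUC A _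
  isClosed := Submodule.isClosed_topologicalClosure _
  shift_mem := fun z f hf => by
    have h1 : berezinSpan (𝒮 : Set (FockSpace n p t →L[ℂ] FockSpace n p t)) ≤
        (berezinSpan (𝒮 : Set (FockSpace n p t →L[ℂ] FockSpace n p t))).comap
          (shiftFunL z : (Cn n →ᵇ ℂ) →ₗ[ℂ] (Cn n →ᵇ ℂ)) := by
      refine berezinSpan_le h𝒮 ((Submodule.isClosed_topologicalClosure _).preimage
        (shiftFunL z).continuous) fun A hA => ?_
      refine subset_closure (Submodule.subset_span ⟨shiftOp z A, hshift z A hA, ?_⟩)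
      funext w
      exact (berezin_shiftOp A z w).symm
    exact h1 hf

/-- For `A ∈ 𝒮` the operator with symbol `Ã` is an average of the orbit of `A`, which stays in the
closed space `𝒮`. -/
lemma toeplitzLin_berezinSpan_le (h𝒮 : ∀ A ∈ 𝒮, A ∈ shiftContinuousAlg n p t)
    (hclosed : IsClosed (𝒮 : Set (FockSpace n p t →L[ℂ] FockSpace n p t)))
    (hshift : ∀ z : Cn n, ∀ A ∈ 𝒮, shiftOp z A ∈ 𝒮) :
    toeplitzLin p t (symbols
      (berezinSpan (𝒮 : Set (FockSpace n p t →L[ℂ] FockSpace n p t)))) ≤ 𝒮 := by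
  have h1 : berezinSpan (𝒮 : Set (FockSpace n p t →L[ℂ] FockSpace n p t)) ≤
      𝒮.comap (toeplitzL p t : (Cn n →ᵇ ℂ) →L[ℂ] _).toLinearMap := by
    refine berezinSpan_le h𝒮 (hclosed.preimage (toeplitzL p t).continuous) fun A hA => ?_
    change toeplitzL p t _ ∈ 𝒮
    rw [toeplitzL_berezinBCF]
    exact integral_gaussian_mem ht.out (uniformContinuous_shiftOp (h𝒮 A hA)).continuous
      (fun z => norm_shiftOp_le z A) hclosed fun z => hshift z A hA
  refine Submodule.topologicalClosure_minimal _ (Submodule.span_le.mpr ?_) hclosed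
  rintro _ ⟨_, ⟨f, hf, rfl⟩, _, rfl⟩
  exact h1 hf

/-- The averages of the orbit of `A` started at `w` are the Toeplitz operators whose symbols are the
Berezin transforms of `α_w(A)`, so the Tauberian step yields `A` itself. -/
lemma le_toeplitzLin_berezinSpan (h𝒮 : ∀ A ∈ 𝒮, A ∈ shiftContinuousAlg n p t)
    (hshift : ∀ z : Cn n, ∀ A ∈ 𝒮, shiftOp z A ∈ 𝒮) :
    𝒮 ≤ toeplitzLin p t (symbols
      (berezinSpan (𝒮 : Set (FockSpace n p t →L[ℂ] FockSpace n p t)))) := by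
  intro A hA
  have h := apply_zero_mem_of_integral_gaussian_mem (u := fun z => shiftOp z A) ht.out
    (uniformContinuous_shiftOp (h𝒮 A hA)).continuous (fun z => norm_shiftOp_le z A)
    (S := toeplitzLin p t (symbols
      (berezinSpan (𝒮 : Set (FockSpace n p t →L[ℂ] FockSpace n p t)))))
    (Submodule.isClosed_topologicalClosure _) fun w => ?_
  · simpa only [shiftOp_zero] using h
  · have hw := hshift w A hA
    have e : ∀ z, shiftOp (w + z) A = shiftOp z (shiftOp w A) := fun z => by
      rw [shiftOp_shiftOp, add_comm]
    simp only [e]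
    rw [← toeplitzL_berezinBCF (h𝒮 _ hw)]
    exact subset_closure (Submodule.subset_span
      ⟨_, ⟨_, berezinBCF_mem_berezinSpan (h𝒮 _ hw) hw, rfl⟩, memLp_top_bcf _, rfl⟩)

lemma berezinSpan_le_of_eq_toeplitzLin {D : Submodule ℂ (Cn n →ᵇ ℂ)}
    (hD : IsClosedInvariantBUC D) (h𝒮 : 𝒮 = toeplitzLin p t (symbols D)) :
    berezinSpan (𝒮 : Set (FockSpace n p t →L[ℂ] FockSpace n p t)) ≤ D := by
  -- The operators with continuous orbit whose Berezin transform lies in `D`. Closedness of `N`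
  -- reduces the claim to the generators `T f` with `f ∈ D`, whose transforms are averages of orbits
  -- in `D`.
  set N : Submodule ℂ (FockSpace n p t →L[ℂ] FockSpace n p t) :=
    (D.comap (berezinL n p t : _ →ₗ[ℂ] (Cn n →ᵇ ℂ))).map
      (shiftContinuousAlg n p t).toSubmodule.subtype with hN
  have hNc : IsClosed (N : Set (FockSpace n p t →L[ℂ] FockSpace n p t)) := by
    have h1 : IsClosed ((shiftContinuousAlg n p t).toSubmodule :
      Set (FockSpace n p t →L[ℂ] FockSpace n p t)) := isClosed_shiftContinuousAlg
    exact h1.isClosedEmbedding_subtypeVal.isClosedMap _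
      (hD.isClosed.preimage (berezinL n p t).continuous)
  have hle : 𝒮 ≤ N := by
    rw [h𝒮]
    refine Submodule.topologicalClosure_minimal _ (Submodule.span_le.mpr ?_) hNc
    rintro _ ⟨_, ⟨f, hf, rfl⟩, _, rfl⟩
    refine ⟨⟨_, toeplitz_mem_shiftContinuousAlg _ (memLp_top_bcf f)⟩, ?_, rfl⟩
    change berezinBCF (toeplitz f (memLp_top_bcf f)) (toeplitz_mem_shiftContinuousAlg _ _) ∈ D
    rw [berezinBCF_toeplitz (hD.le_BUC hf)]
    exact integral_gaussian_mem ht.out (continuous_shiftFun (hD.le_BUC hf))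
      (fun z => norm_shiftFun_le z f) hD.isClosed fun z => hD.shift_mem z f hf
  have hmem : ∀ A ∈ 𝒮, ∃ hA : A ∈ shiftContinuousAlg n p t, berezinBCF A hA ∈ D := by
    intro A hA
    obtain ⟨B, hB, rfl⟩ := hle hA
    exact ⟨B.2, hB⟩
  exact berezinSpan_le (fun A hA => (hmem A hA).1) hD.isClosed fun A hA => (hmem A hA).2

/-- The Tauberian step for functions: the averages of the orbit of `f` started at `w` are Berezin
transforms of the operators `T (α_w f) ∈ 𝒮`. -/
lemma le_berezinSpan_of_eq_toeplitzLin {D : Submodule ℂ (Cn n →ᵇ ℂ)}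
    (hD : IsClosedInvariantBUC D) (h𝒮 : 𝒮 = toeplitzLin p t (symbols D)) :
    D ≤ berezinSpan (𝒮 : Set (FockSpace n p t →L[ℂ] FockSpace n p t)) := by
  intro f hf
  have h := apply_zero_mem_of_integral_gaussian_mem (u := fun z => shiftFun z f) ht.out
    (continuous_shiftFun (hD.le_BUC hf)) (fun z => norm_shiftFun_le z f)
    (S := berezinSpan (𝒮 : Set (FockSpace n p t →L[ℂ] FockSpace n p t)))
    (Submodule.isClosed_topologicalClosure _) fun w => ?_
  · have e : shiftFun 0 f = f := by ext x; simp
    simpa only [e] using h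
  · have hw := hD.shift_mem w f hf
    have e : ∀ z, shiftFun (w + z) f = shiftFun z (shiftFun w f) := fun z => by
      rw [shiftFun_shiftFun, add_comm]
    simp only [e]
    rw [← berezinBCF_toeplitz (p := p) (hD.le_BUC hw)]
    refine berezinBCF_mem_berezinSpan _ ?_
    rw [h𝒮]
    exact subset_closure (Submodule.subset_span ⟨_, ⟨_, hw, rfl⟩, memLp_top_bcf _, rfl⟩)

end

end Fock

end

theorem mainTheorem4 (n : ℕ) (p t : ℝ) [Fact (1 < p)] [Fact (0 < t)]
    (𝒮 : Submodule ℂ (Fock.FockSpace n p t →L[ℂ] Fock.FockSpace n p t))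
    (h𝒮_le : ∀ A ∈ 𝒮, A ∈ Fock.fullToeplitzAlg n p t)
    (h𝒮_closed : IsClosed (𝒮 : Set (Fock.FockSpace n p t →L[ℂ] Fock.FockSpace n p t)))
    (h𝒮_shift : ∀ z : Fock.Cn n, ∀ A ∈ 𝒮, Fock.shiftOp z A ∈ 𝒮) :
    (∀ A ∈ 𝒮, ∃ g ∈ Fock.BUC n, (g : Fock.Cn n → ℂ) = Fock.berezin A) ∧
    (∃ 𝒟₀ : Submodule ℂ (Fock.Cn n →ᵇ ℂ), Fock.IsClosedInvariantBUC 𝒟₀ ∧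
      𝒮 = Fock.toeplitzLin p t (Fock.symbols 𝒟₀)) ∧
    (∀ 𝒟₀ : Submodule ℂ (Fock.Cn n →ᵇ ℂ), Fock.IsClosedInvariantBUC 𝒟₀ →
      𝒮 = Fock.toeplitzLin p t (Fock.symbols 𝒟₀) →
      𝒟₀ = Fock.berezinSpan (𝒮 : Set (Fock.FockSpace n p t →L[ℂ] Fock.FockSpace n p t))) := by
  -- Containment in the Toeplitz algebra enters only through norm continuity of orbits.
  have h𝒮 : ∀ A ∈ 𝒮, A ∈ Fock.shiftContinuousAlg n p t := fun A hA =>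
    Fock.fullToeplitzAlg_le_shiftContinuousAlg (h𝒮_le A hA)
  refine ⟨fun A hA => ⟨Fock.berezinBCF A (h𝒮 A hA), Fock.berezinBCF_mem_BUC A _, rfl⟩,
    ⟨_, Fock.isClosedInvariantBUC_berezinSpan h𝒮 h𝒮_shift,
      le_antisymm (Fock.le_toeplitzLin_berezinSpan h𝒮 h𝒮_shift)
        (Fock.toeplitzLin_berezinSpan_le h𝒮 h𝒮_closed h𝒮_shift)⟩,
    fun D hD hSD => le_antisymm (Fock.le_berezinSpan_of_eq_toeplitzLin hD hSD)
      (Fock.berezinSpan_le_of_eq_toeplitzLin hD hSD)⟩
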